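/- **Conventions.** $\mathbb F$ is a field of characteristic $0$, and $T$, $\mathbf w=(w_1,\dots,w_n)$, $y$, $z$ are variables. An *algebraic circuit* is a finite directed acyclic graph whose leaves carry variables or constants of $\mathbb F$ and whose internal nodes are sum or product gates of unbounded fan-in. Its *size* is its number of edges, counted with multiplicity, and its *depth* is the length of the longest path from a leaf to the output. A polynomial "has a circuit of depth $\Delta$ and size $s$" if some circuit of depth at most $\Delta$ and size at most $s$ computes it. Let $P\in\mathbb F[T,\mathbf w,y,z]$ and $R\in\mathbb F[T,\mathbf w,y]$. - $P$ is *monic in $z$* if the coefficient of its highest power of $z$ is a nonzero constant of $\mathbb F$. - $P$ is *$T$-regularized* if $P(0,\mathbf w,y,z)\in\mathbb F[z]$, i.e. every monomial of $P$ that depends on $\mathbf w$ or $y$ is divisible by $T$. - $R$ is an *approximate $z$-root of $P$ of order $k$* if $P(T,\mathbf w,y,R(T,\mathbf w,y))\equiv 0 \bmod T^k$. It is *truncated* if $\deg_T R<k$, and *non-degenerate* if $(\partial_z P)(0,\mathbf 0,0,\alpha)\neq 0$ for $\alpha=R(0,\mathbf 0,0)$. **Lemma.** There are a constant $c\in\mathbb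 N$ and polynomials $p\in\mathbb N[X_0,X_1]$, $q\in\mathbb N[X]$ such that the following holds for every field $\mathbb F$ of characteristic $0$, all $n,\Delta,s,\ell\in\mathbb N$ and every natural number $k>1$. Let $P\in\mathbb F[T,\mathbf w,y,z]$ have a circuit of depth $\Delta$ and size $s$, and let $P$ be $T$-regularized and monic in $z$. Let $R\in\mathbb F[T,\mathbf w,y]$ be a truncated, non-degenerate, approximate $z$-root of $P$ of order $k$, and suppose that the polynomial $P(T,\mathbf w,y,R(T,\mathbf w,y))$ is not identically zero. Let $F\in\mathbb F[\mathbf w]$ have degree at most $\ell$ and suppose that $y-F(\mathbf w)$ divides $P(T,\mathbf w,y,R(T,\mathbf w,y))$. Then $F$ has a circuit of depth $\Delta+c$ and size $$p(s,\deg P)\cdot\bigl(1+\lfloor\log_2 k\rfloor\bigr)^{q(\ell)} .$$ -/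

import Mathlib

/-- A node of an algebraic circuit with node set `V`: a leaf carrying a variable or a field
constant, or a sum / product gate of unbounded fan-in.  The inputs of a gate form a multiset,
so parallel edges are allowed; they are counted with multiplicity. -/
inductive CircuitGate (𝔽 : Type*) (σ : Type*) (V : Type) where
  | var (x : σ) : CircuitGate 𝔽 σ V
  | const (a : 𝔽) : CircuitGate 𝔽 σ V
  | add (S : Multiset V) : CircuitGate 𝔽 σ V
  | mul (S : Multiset V) : CircuitGate 𝔽 σ V

/-- The nodes with an edge into the given node. -/
def CircuitGate.inputs {𝔽 : Type*} {σ : Type*} {V : Type} : CircuitGate 𝔽 σ V → Multiset V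
  | .var _ => 0
  | .const _ => 0
  | .add S => S
  | .mul S => S

/-- An algebraic circuit over `𝔽` in the variables `σ`: a finite directed acyclic graph of
nodes, with a designated output node.  For a finite graph, acyclicity is the well-foundedness of
the edge relation.  (A gate without inputs is the constant `0` or `1`; it behaves as a leaf.) -/
structure AlgCircuit (𝔽 : Type*) (σ : Type*) where
  Node : Type
  [fintypeNode : Fintype Node]
  gate : Node → CircuitGate 𝔽 σ Node
  acyclic : WellFounded (fun u v : Node => u ∈ (gate v).inputs)
  output : Node

namespace AlgCircuit

attribute [instance] AlgCircuit.fintypeNode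

variable {𝔽 : Type*} {σ : Type*}

/-- The polynomial computed at a node. -/
noncomputable def value [Field 𝔽] (C : AlgCircuit 𝔽 σ) : C.Node → MvPolynomial σ 𝔽 :=
  C.acyclic.fix fun v ih =>
    match C.gate v with
    | .var x => MvPolynomial.X x
    | .const a => MvPolynomial.C a
    | .add _ => ((C.gate v).inputs.attach.map fun u => ih u.1 u.2).sum
    | .mul _ => ((C.gate v).inputs.attach.map fun u => ih u.1 u.2).prod

/-- The number of edges on the longest path from a leaf to a node. -/
noncomputable def nodeDepth (C : AlgCircuit 𝔽 σ) : C.Node → ℕ :=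
  C.acyclic.fix fun v ih => ((C.gate v).inputs.attach.map fun u => ih u.1 u.2 + 1).sup

/-- The depth of a circuit: the length of the longest path from a leaf to the output. -/
noncomputable def depth (C : AlgCircuit 𝔽 σ) : ℕ := C.nodeDepth C.output

/-- The size of a circuit: its number of edges. -/
noncomputable def size (C : AlgCircuit 𝔽 σ) : ℕ := ∑ v : C.Node, (C.gate v).inputs.card

theorem value_eq [Field 𝔽] (C : AlgCircuit 𝔽 σ) (v : C.Node) :
    C.value v =
      match C.gate v with
      | .var x => MvPolynomial.X x
      | .const a => MvPolynomial.C a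
      | .add S => (S.map C.value).sum
      | .mul S => (S.map C.value).prod := by
  have h : C.value v =
      match C.gate v with
      | .var x => MvPolynomial.X x
      | .const a => MvPolynomial.C a
      | .add _ => ((C.gate v).inputs.attach.map fun u => C.value u.1).sum
      | .mul _ => ((C.gate v).inputs.attach.map fun u => C.value u.1).prod := by
    unfold value
    rw [WellFounded.fix_eq]
  rw [h, Multiset.attach_map_val' (C.gate v).inputs C.value]
  cases C.gate v <;> rfl

theorem nodeDepth_eq (C : AlgCircuit 𝔽 σ) (v : C.Node) :
    C.nodeDepth v = ((C.gate v).inputs.map fun u => C.nodeDepth u + 1).sup := by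
  have h : C.nodeDepth v = ((C.gate v).inputs.attach.map fun u => C.nodeDepth u.1 + 1).sup := by
    unfold nodeDepth
    rw [WellFounded.fix_eq]
  rw [h, Multiset.attach_map_val' (C.gate v).inputs fun u => C.nodeDepth u + 1]

end AlgCircuit

/-- `f` is computed by an algebraic circuit of depth at most `Δ` and size at most `s`. -/
def HasCircuit {𝔽 : Type*} [Field 𝔽] {σ : Type*} (f : MvPolynomial σ 𝔽) (Δ s : ℕ) : Prop :=
  ∃ C : AlgCircuit 𝔽 σ, C.value C.output = f ∧ C.depth ≤ Δ ∧ C.size ≤ s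

/-- The variables `T, x` (with `x` a tuple indexed by `σ`). -/
inductive VarTX (σ : Type*) where
  | T : VarTX σ
  | x (i : σ) : VarTX σ

/-- The variables `T, x, z` (with `x` a tuple indexed by `σ`). -/
inductive VarTXZ (σ : Type*) where
  | T : VarTXZ σ
  | x (i : σ) : VarTXZ σ
  | z : VarTXZ σ

/-- The variables `w₁, …, wₙ, y`. -/
inductive VarWY (n : ℕ) where
  | w (i : Fin n) : VarWY n
  | y : VarWY n

section Roots

variable {𝔽 : Type*} [Field 𝔽] {σ : Type*}

/-- `P` is monic in `z`: the coefficient of its highest power `z ^ d`, a polynomial in the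
other variables, is a nonzero field constant; that is, `z ^ d` is the only monomial of `P` of
`z`-degree `d`. -/
def IsMonicInZ (P : MvPolynomial (VarTXZ σ) 𝔽) : Prop :=
  P ≠ 0 ∧ ∀ m ∈ P.support, m VarTXZ.z = P.degreeOf VarTXZ.z →
    m = Finsupp.single VarTXZ.z (P.degreeOf VarTXZ.z)

/-- `P(0, x, z)` lies in `𝔽[z]`: every monomial of `P` that depends on `x` is divisible
by `T`. -/
def IsTRegularized (P : MvPolynomial (VarTXZ σ) 𝔽) : Prop :=
  ∀ m ∈ P.support, (∃ i : σ, m (VarTXZ.x i) ≠ 0) → m VarTXZ.T ≠ 0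

/-- The polynomial `P(T, x, Φ(T, x))`. -/
noncomputable def substZ (P : MvPolynomial (VarTXZ σ) 𝔽) (Φ : MvPolynomial (VarTX σ) 𝔽) :
    MvPolynomial (VarTX σ) 𝔽 :=
  MvPolynomial.aeval
    (fun v : VarTXZ σ => match v with
      | .T => MvPolynomial.X VarTX.T
      | .x i => MvPolynomial.X (VarTX.x i)
      | .z => Φ) P

/-- `P(T, x, Φ(T, x)) ≡ 0 mod T ^ k`. -/
def IsApproxRoot (P : MvPolynomial (VarTXZ σ) 𝔽) (Φ : MvPolynomial (VarTX σ) 𝔽) (k : ℕ) : Prop :=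
  MvPolynomial.X VarTX.T ^ k ∣ substZ P Φ

/-- An approximate root of order `k` is truncated if its `T`-degree is less than `k`. -/
def IsTruncated (Φ : MvPolynomial (VarTX σ) 𝔽) (k : ℕ) : Prop :=
  Φ.degreeOf VarTX.T < k

/-- `(∂P/∂z)(0, 0, α) ≠ 0`, where `α = Φ(0, 0)`. -/
def IsNondegenerate (P : MvPolynomial (VarTXZ σ) 𝔽) (Φ : MvPolynomial (VarTX σ) 𝔽) : Prop :=
  MvPolynomial.eval
    (fun v : VarTXZ σ => match v with
      | .T => 0
      | .x _ => 0
      | .z => MvPolynomial.eval (fun _ : VarTX σ => (0 : 𝔽)) Φ)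
    (MvPolynomial.pderiv VarTXZ.z P) ≠ 0

end Roots

/-- The polynomial `y - F(w)` in `𝔽[T, w, y]`. -/
noncomputable def ySub {𝔽 : Type*} [Field 𝔽] {n : ℕ} (F : MvPolynomial (Fin n) 𝔽) :
    MvPolynomial (VarTX (VarWY n)) 𝔽 :=
  MvPolynomial.X (VarTX.x VarWY.y) - MvPolynomial.rename (fun i => VarTX.x (VarWY.w i)) F

/-!
# Low-degree roots hidden in an approximate root

Put `S = 𝔽[w]`.  Since `R` is truncated at order `k`, the first nonzero coefficient in `T` of
`P(T, w, y, R)`, say at `T ^ m` with `m ≥ k`, is up to a constant the coefficient of `T ^ m` of a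
root `φ` of `P` modulo `T ^ (m + 1)`, obtained from `R` by one Newton step
(`exists_root_mod_X_pow`).  Here `T`-regularity makes `∂P/∂z` at the root a nonzero constant modulo
`T`.  Hence `F` is a root in `y` of the polynomial `[T ^ m] φ`, and a simple root of some iterated
`y`-derivative `M` of it (`exists_iterate_derivative_simple_root`).

A root of degree at most `ℓ` that is simple at a point `a` is given by Newton iteration along the
lines through `a`.  The iteration is universal: there are polynomials, of size depending on `ℓ`
only, which express the first `ℓ` coefficients of the root along a line by the low-order Taylor
coefficients of the equation (`newtonIter`, `X_pow_dvd_sub_newtonIter`).  This is used twice: for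
`F` as a root of `M`, and for the restriction of `φ` to lines in `w`, as a root of `P`.

The large parameters `m` and the order of the derivative enter only through the functional
`[T ^ m y ^ j]`, which is applied to the outcome of the second iteration.  That outcome is a
polynomial of small degree in `T`, `y`, the root `φ₀` at `w = a` and the inverse of `∂P/∂z` at
`φ₀`; the last two lie in `𝔽[y][T]`.  So the functional is an `S`-linear one on `S[T, y, Z, U]` with
values in `𝔽` on monomials (`exists_functional`), and on polynomials of small degree it is a
short linear combination of evaluations at points of a grid (`exists_interpolation`).  The Taylor
coefficients of `P` are obtained by interpolation as well.  All steps have constant depth, sizes are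
multiplicative under composition (`HasCircuit.comp`), and the resulting bound is a polynomial in
`s` and `deg P` times `2 ^ q(ℓ)`, where `2 ≤ 1 + log₂ k`.
-/

/-! ### Composition of circuits -/

/-- Relabelling of the input nodes of a gate. -/
def CircuitGate.map {𝔽 σ : Type*} {V W : Type} (h : V → W) :
    CircuitGate 𝔽 σ V → CircuitGate 𝔽 σ W
  | .var x => .var x
  | .const a => .const a
  | .add S => .add (S.map h)
  | .mul S => .mul (S.map h)

theorem CircuitGate.inputs_map {𝔽 σ : Type*} {V W : Type} (h : V → W)
    (g : CircuitGate 𝔽 σ V) : (g.map h).inputs = g.inputs.map h := by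
  cases g <;> simp [CircuitGate.map, CircuitGate.inputs]

namespace AlgCircuit

variable {𝔽 : Type*} {σ τ : Type*}

/-- The circuit with a single constant node. -/
def constCircuit (σ : Type*) (a : 𝔽) : AlgCircuit 𝔽 σ where
  Node := Unit
  gate _ := .const a
  acyclic := ⟨fun v => ⟨v, fun _ h => by simp [CircuitGate.inputs] at h⟩⟩
  output := ()

theorem nodeDepth_le_iff (C : AlgCircuit 𝔽 σ) (v : C.Node) (d : ℕ) :
    C.nodeDepth v ≤ d ↔ ∀ u ∈ (C.gate v).inputs, C.nodeDepth u + 1 ≤ d := by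
  rw [nodeDepth_eq, Multiset.sup_le]
  simp

theorem depth_constCircuit (a : 𝔽) : (constCircuit σ a).depth = 0 :=
  Nat.le_zero.1 <| ((constCircuit σ a).nodeDepth_le_iff _ 0).2 fun u hu =>
    absurd hu (Multiset.notMem_zero u)

theorem size_constCircuit (a : 𝔽) : (constCircuit σ a).size = 0 :=
  Finset.sum_eq_zero fun _ _ => rfl

/-- A node is used if it is the output or has an edge to some gate. -/
def Used (C : AlgCircuit 𝔽 σ) (v : C.Node) : Prop :=
  v = C.output ∨ ∃ u, v ∈ (C.gate u).inputs

open Classical in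
theorem card_used_le (C : AlgCircuit 𝔽 σ) : Fintype.card {v // C.Used v} ≤ C.size + 1 := by
  rw [Fintype.card_subtype]
  calc _ ≤ (insert C.output
        (Finset.univ.biUnion fun u => (C.gate u).inputs.toFinset)).card := by
        refine Finset.card_le_card fun v hv => ?_
        obtain rfl | ⟨u, hu⟩ := (Finset.mem_filter.1 hv).2
        · exact Finset.mem_insert_self _ _
        · exact Finset.mem_insert_of_mem (Finset.mem_biUnion.2
            ⟨u, Finset.mem_univ _, Multiset.mem_toFinset.2 hu⟩)
    _ ≤ _ := by
        refine (Finset.card_insert_le _ _).trans (Nat.add_le_add_right ?_ 1)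
        exact Finset.card_biUnion_le.trans
          (Finset.sum_le_sum fun u _ => Multiset.toFinset_card_le _)

variable [Field 𝔽]

/-- The circuit substituted at a node of `C` when the variables are replaced by the outputs of the
circuits `D x`; at a node that is not a variable leaf it plays no role. -/
def leafCircuit (C : AlgCircuit 𝔽 σ) (D : σ → AlgCircuit 𝔽 τ) (v : C.Node) : AlgCircuit 𝔽 τ :=
  match C.gate v with
  | .var x => D x
  | _ => constCircuit τ 0

open Classical in
/-- The gates of the substituted circuit: every used variable leaf of `C` gets its own copy of the
circuit for that variable, and becomes a sum gate with a single input. -/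
noncomputable def substGate (C : AlgCircuit 𝔽 σ) (D : σ → AlgCircuit 𝔽 τ) :
    C.Node ⊕ (Σ v : {v // C.Used v}, (C.leafCircuit D v.1).Node) →
    CircuitGate 𝔽 τ (C.Node ⊕ (Σ v : {v // C.Used v}, (C.leafCircuit D v.1).Node))
  | .inl v =>
    match C.gate v with
    | .var _ => if h : C.Used v then .add {.inr ⟨⟨v, h⟩, (C.leafCircuit D v).output⟩} else .const 0
    | .const a => .const a
    | .add S => .add (S.map .inl)
    | .mul S => .mul (S.map .inl)
  | .inr x => ((C.leafCircuit D x.1.1).gate x.2).map fun y => .inr ⟨x.1, y⟩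

theorem inputs_substGate_inl (C : AlgCircuit 𝔽 σ) (D : σ → AlgCircuit 𝔽 τ) (v : C.Node) :
    (C.substGate D (.inl v)).inputs = (C.gate v).inputs.map .inl ∨
    ∃ h : C.Used v, (C.substGate D (.inl v)).inputs =
      {.inr ⟨⟨v, h⟩, (C.leafCircuit D v).output⟩} := by
  by_cases hu : C.Used v
  · cases h : C.gate v <;> simp [substGate, h, CircuitGate.inputs, hu]
  · cases h : C.gate v <;> simp [substGate, h, CircuitGate.inputs, hu]

theorem inputs_substGate_inr (C : AlgCircuit 𝔽 σ) (D : σ → AlgCircuit 𝔽 τ)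
    (v : {v // C.Used v}) (x : (C.leafCircuit D v.1).Node) :
    (C.substGate D (.inr ⟨v, x⟩)).inputs =
      ((C.leafCircuit D v.1).gate x).inputs.map fun y => .inr ⟨v, y⟩ := by
  simp [substGate, CircuitGate.inputs_map]

theorem substGate_acyclic (C : AlgCircuit 𝔽 σ) (D : σ → AlgCircuit 𝔽 τ) :
    WellFounded fun u v => u ∈ (C.substGate D v).inputs := by
  have hr : ∀ (v : {v // C.Used v}) (x : (C.leafCircuit D v.1).Node),
      Acc (fun u v => u ∈ (C.substGate D v).inputs) (.inr ⟨v, x⟩) := by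
    intro v x
    induction x using (C.leafCircuit D v.1).acyclic.induction with
    | _ x ih =>
      refine ⟨_, fun u hu => ?_⟩
      rw [inputs_substGate_inr, Multiset.mem_map] at hu
      obtain ⟨y, hy, rfl⟩ := hu
      exact ih y hy
  refine ⟨fun v => ?_⟩
  obtain v | ⟨v, x⟩ := v
  · induction v using C.acyclic.induction with
    | _ v ih =>
      refine ⟨_, fun u hu => ?_⟩
      obtain h | ⟨h', h⟩ := C.inputs_substGate_inl D v
      · rw [h, Multiset.mem_map] at hu
        obtain ⟨y, hy, rfl⟩ := hu
        exact ih y hy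
      · rw [h, Multiset.mem_singleton] at hu
        rw [hu]
        exact hr _ _
  · exact hr _ _

open Classical in
/-- The circuit obtained from `C` by feeding the outputs of the circuits `D x` into its
variable leaves. -/
noncomputable abbrev subst (C : AlgCircuit 𝔽 σ) (D : σ → AlgCircuit 𝔽 τ) : AlgCircuit 𝔽 τ where
  Node := C.Node ⊕ (Σ v : {v // C.Used v}, (C.leafCircuit D v.1).Node)
  gate := C.substGate D
  acyclic := C.substGate_acyclic D
  output := .inl C.output

theorem value_subst_inr (C : AlgCircuit 𝔽 σ) (D : σ → AlgCircuit 𝔽 τ)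
    (v : {v // C.Used v}) (x : (C.leafCircuit D v.1).Node) :
    (C.subst D).value (.inr ⟨v, x⟩) = (C.leafCircuit D v.1).value x := by
  induction x using (C.leafCircuit D v.1).acyclic.induction with
  | _ x ih =>
    rw [value_eq, value_eq]
    have hg : (C.subst D).gate (.inr ⟨v, x⟩) =
      ((C.leafCircuit D v.1).gate x).map fun y => .inr ⟨v, y⟩ := by simp [subst, substGate]
    rw [hg]
    cases h : (C.leafCircuit D v.1).gate x with
    | var i => rfl
    | const a => rfl
    | add S =>
      simp only [CircuitGate.map, Multiset.map_map]
      exact congrArg _ (Multiset.map_congr rfl fun y hy => ih y (by rw [h]; exact hy))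
    | mul S =>
      simp only [CircuitGate.map, Multiset.map_map]
      exact congrArg _ (Multiset.map_congr rfl fun y hy => ih y (by rw [h]; exact hy))

theorem value_subst_inl (C : AlgCircuit 𝔽 σ) (D : σ → AlgCircuit 𝔽 τ) (v : C.Node)
    (hv : C.Used v) : (C.subst D).value (.inl v) =
      MvPolynomial.aeval (fun x => (D x).value (D x).output) (C.value v) := by
  induction v using C.acyclic.induction with
  | _ v ih =>
    have ih' : ∀ u ∈ (C.gate v).inputs, (C.subst D).value (.inl u) =
      MvPolynomial.aeval (fun x => (D x).value (D x).output) (C.value u) :=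
      fun u hu => ih u hu (.inr ⟨v, hu⟩)
    rw [value_eq, value_eq]
    cases h : C.gate v with
    | var i =>
      have hg : (C.subst D).gate (.inl v) =
          .add {.inr ⟨⟨v, hv⟩, (C.leafCircuit D v).output⟩} := by
        simp [subst, substGate, h, hv]
      have hl : C.leafCircuit D v = D i := by simp [leafCircuit, h]
      rw [hg]
      simp only [Multiset.map_singleton, Multiset.sum_singleton, value_subst_inr,
        MvPolynomial.aeval_X]
      rw [hl]
    | const a =>
      have hg : (C.subst D).gate (.inl v) = .const a := by simp [subst, substGate, h]
      rw [hg]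
      simp [MvPolynomial.algebraMap_eq]
    | add S =>
      have hg : (C.subst D).gate (.inl v) = .add (S.map .inl) := by simp [subst, substGate, h]
      rw [hg]
      simp only [Multiset.map_map, map_multiset_sum]
      exact congrArg _ (Multiset.map_congr rfl fun y hy => ih' y (by rw [h]; exact hy))
    | mul S =>
      have hg : (C.subst D).gate (.inl v) = .mul (S.map .inl) := by simp [subst, substGate, h]
      rw [hg]
      simp only [Multiset.map_map, map_multiset_prod]
      exact congrArg _ (Multiset.map_congr rfl fun y hy => ih' y (by rw [h]; exact hy))

theorem nodeDepth_subst_inr_le (C : AlgCircuit 𝔽 σ) (D : σ → AlgCircuit 𝔽 τ)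
    (v : {v // C.Used v}) (x : (C.leafCircuit D v.1).Node) :
    (C.subst D).nodeDepth (.inr ⟨v, x⟩) ≤ (C.leafCircuit D v.1).nodeDepth x := by
  induction x using (C.leafCircuit D v.1).acyclic.induction with
  | _ x ih =>
    rw [nodeDepth_le_iff]
    intro u hu
    replace hu : u ∈ (C.substGate D (.inr ⟨v, x⟩)).inputs := hu
    rw [inputs_substGate_inr, Multiset.mem_map] at hu
    obtain ⟨y, hy, rfl⟩ := hu
    exact (Nat.add_le_add_right (ih y hy) 1).trans
      (((C.leafCircuit D v.1).nodeDepth_le_iff x _).1 le_rfl y hy)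

theorem depth_leafCircuit_le (C : AlgCircuit 𝔽 σ) (D : σ → AlgCircuit 𝔽 τ) {d : ℕ}
    (hd : ∀ x, (D x).depth ≤ d) (v : C.Node) : (C.leafCircuit D v).depth ≤ d := by
  unfold leafCircuit
  split
  · exact hd _
  · simp [depth_constCircuit]

theorem size_leafCircuit_le (C : AlgCircuit 𝔽 σ) (D : σ → AlgCircuit 𝔽 τ) {s : ℕ}
    (hs : ∀ x, (D x).size ≤ s) (v : C.Node) : (C.leafCircuit D v).size ≤ s := by
  unfold leafCircuit
  split
  · exact hs _
  · simp [size_constCircuit]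

theorem nodeDepth_subst_inl_le (C : AlgCircuit 𝔽 σ) (D : σ → AlgCircuit 𝔽 τ) {d : ℕ}
    (hd : ∀ x, (D x).depth ≤ d) (v : C.Node) :
    (C.subst D).nodeDepth (.inl v) ≤ C.nodeDepth v + d + 1 := by
  induction v using C.acyclic.induction with
  | _ v ih =>
    rw [nodeDepth_le_iff]
    intro u hu
    replace hu : u ∈ (C.substGate D (.inl v)).inputs := hu
    obtain h | ⟨h', h⟩ := C.inputs_substGate_inl D v
    · rw [h, Multiset.mem_map] at hu
      obtain ⟨y, hy, rfl⟩ := hu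
      have h1 := ih y hy
      have h2 := (C.nodeDepth_le_iff v _).1 le_rfl y hy
      omega
    · rw [h, Multiset.mem_singleton] at hu
      subst hu
      have h1 := (C.nodeDepth_subst_inr_le D ⟨v, h'⟩ (C.leafCircuit D v).output).trans
        (C.depth_leafCircuit_le D hd v)
      omega

open Classical in
theorem size_subst_le (C : AlgCircuit 𝔽 σ) (D : σ → AlgCircuit 𝔽 τ) {s : ℕ}
    (hs : ∀ x, (D x).size ≤ s) : (C.subst D).size ≤ (C.size + 1) * (s + 2) := by
  have h0 : (C.subst D).size = (∑ v : C.Node, (C.substGate D (.inl v)).inputs.card) +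
      ∑ v : {v // C.Used v}, (C.leafCircuit D v.1).size := by
    have : (C.subst D).size = ∑ v : C.Node ⊕ (Σ v : {v // C.Used v}, (C.leafCircuit D v.1).Node),
      (C.substGate D v).inputs.card := rfl
    rw [this, Fintype.sum_sum_type, Fintype.sum_sigma]
    congr 1
    refine Finset.sum_congr rfl fun v _ => Finset.sum_congr rfl fun x _ => ?_
    rw [inputs_substGate_inr, Multiset.card_map]
  have h1 : (∑ v : C.Node, (C.substGate D (.inl v)).inputs.card) ≤
      C.size + Fintype.card {v // C.Used v} := by
    rw [size, Fintype.card_subtype, Finset.card_filter, ← Finset.sum_add_distrib]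
    refine Finset.sum_le_sum fun v _ => ?_
    obtain h | ⟨h', h⟩ := C.inputs_substGate_inl D v
    · rw [h, Multiset.card_map]
      exact Nat.le_add_right _ _
    · simp [h, h']
  have h2 : ∑ v : {v // C.Used v}, (C.leafCircuit D v.1).size ≤
      Fintype.card {v // C.Used v} * s := by
    refine (Finset.sum_le_card_nsmul _ _ s fun v _ => C.size_leafCircuit_le D hs v.1).trans ?_
    simp
  have h3 := C.card_used_le
  rw [h0]
  nlinarith [Nat.mul_le_mul_right s h3]

end AlgCircuit

section HasCircuit

variable {𝔽 : Type*} [Field 𝔽] {σ τ : Type*}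

theorem HasCircuit.mono {f : MvPolynomial σ 𝔽} {Δ Δ' s s' : ℕ} (h : HasCircuit f Δ s)
    (hΔ : Δ ≤ Δ') (hs : s ≤ s') : HasCircuit f Δ' s' := by
  obtain ⟨C, h1, h2, h3⟩ := h
  exact ⟨C, h1, h2.trans hΔ, h3.trans hs⟩

theorem hasCircuit_C (a : 𝔽) (Δ s : ℕ) : HasCircuit (MvPolynomial.C a : MvPolynomial σ 𝔽) Δ s := by
  refine ⟨.constCircuit σ a, ?_, ?_, ?_⟩
  · rw [AlgCircuit.value_eq]
    rfl
  · simp [AlgCircuit.depth_constCircuit]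
  · simp [AlgCircuit.size_constCircuit]

/-- Substituting circuits into a circuit: depths add up, and the sizes, increased by `2`,
multiply. -/
theorem HasCircuit.comp {g : MvPolynomial σ 𝔽} {f : σ → MvPolynomial τ 𝔽} {Δ₁ Δ₂ s₁ s₂ : ℕ}
    (hg : HasCircuit g Δ₁ s₁) (hf : ∀ i, HasCircuit (f i) Δ₂ s₂) :
    HasCircuit (MvPolynomial.aeval f g) (Δ₁ + Δ₂ + 1) ((s₁ + 2) * (s₂ + 2) - 2) := by
  obtain ⟨C, rfl, h2, h3⟩ := hg
  choose D hD1 hD2 hD3 using hf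
  refine ⟨C.subst D, ?_, ?_, ?_⟩
  · have h := C.value_subst_inl D C.output (.inl rfl)
    simp only [hD1] at h
    exact h
  · refine (C.nodeDepth_subst_inl_le D hD2 C.output).trans ?_
    change C.depth + _ + 1 ≤ _
    omega
  · refine (C.size_subst_le D hD3).trans (Nat.le_sub_of_add_le ?_)
    nlinarith

/-- The sum-of-monomials circuit. -/
theorem hasCircuit_of_card_support_le {σ : Type} [Fintype σ] (g : MvPolynomial σ 𝔽) {N E : ℕ}
    (hN : g.support.card ≤ N) (hE : g.totalDegree ≤ E) : HasCircuit g 2 (N * (E + 2)) := by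
  classical
  let V : Type := Option (g.support ⊕ (g.support ⊕ σ))
  let gate : V → CircuitGate 𝔽 σ V := fun v => match v with
    | none => .add (Finset.univ.val.map fun m => some (.inl m))
    | some (.inl m) => .mul (some (.inr (.inl m)) ::ₘ
        (Finsupp.toMultiset m.1).map fun x => some (.inr (.inr x)))
    | some (.inr (.inl m)) => .const (g.coeff m)
    | some (.inr (.inr x)) => .var x
  let rk : V → ℕ := fun v => match v with
    | none => 2
    | some (.inl m) => 1
    | some (.inr _) => 0
  have hrk : ∀ u v, u ∈ (gate v).inputs → rk u < rk v := by
    rintro u (_ | m | m | x) hu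
    · simp only [gate, CircuitGate.inputs, Multiset.mem_map] at hu
      obtain ⟨m, -, rfl⟩ := hu
      simp [rk]
    · simp only [gate, CircuitGate.inputs, Multiset.mem_cons, Multiset.mem_map] at hu
      obtain rfl | ⟨m, -, rfl⟩ := hu <;> simp [rk]
    · simp [gate, CircuitGate.inputs] at hu
    · simp [gate, CircuitGate.inputs] at hu
  let C : AlgCircuit 𝔽 σ :=
    { Node := V
      gate := gate
      acyclic := Subrelation.wf (fun {u v} h => hrk u v h) (measure rk).wf
      output := none }
  have hdep : ∀ v : V, C.nodeDepth v ≤ rk v := by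
    intro v
    induction v using C.acyclic.induction with
    | _ v ih =>
      rw [AlgCircuit.nodeDepth_le_iff]
      exact fun u hu => (Nat.succ_le_succ (ih u hu)).trans (hrk u v hu)
  have hvar : ∀ x, C.value (some (.inr (.inr x))) = MvPolynomial.X x := fun x => by
    rw [AlgCircuit.value_eq]
  have hconst : ∀ m : g.support, C.value (some (.inr (.inl m))) = MvPolynomial.C (g.coeff m) :=
    fun m => by rw [AlgCircuit.value_eq]
  have hmon : ∀ m : g.support,
      C.value (some (.inl m)) = MvPolynomial.monomial m.1 (g.coeff m) := by
    intro m
    rw [AlgCircuit.value_eq]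
    change (Multiset.map C.value (_ ::ₘ Multiset.map _ _)).prod = _
    rw [Multiset.map_cons, Multiset.prod_cons, Multiset.map_map, hconst]
    simp only [Function.comp_def, hvar]
    rw [MvPolynomial.monomial_eq, Finsupp.toMultiset_map, Finsupp.prod_toMultiset,
      Finsupp.prod_mapDomain_index (fun _ => pow_zero _) fun _ _ _ => pow_add _ _ _]
  have hout : C.value none = g := by
    rw [AlgCircuit.value_eq]
    change (Multiset.map C.value (Multiset.map _ _)).sum = _
    rw [Multiset.map_map]
    simp only [Function.comp_def, hmon]
    conv_rhs => rw [g.as_sum, ← Finset.sum_coe_sort]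
    rfl
  refine ⟨C, hout, hdep none, ?_⟩
  have hs : C.size = ∑ v : V, (gate v).inputs.card := rfl
  rw [hs]
  simp only [V, Fintype.sum_option, Fintype.sum_sum_type]
  have h1 : ∀ m : g.support, (gate (some (.inl m))).inputs.card ≤ E + 1 := by
    intro m
    simp only [gate, CircuitGate.inputs, Multiset.card_cons, Multiset.card_map]
    rw [Finsupp.card_toMultiset]
    exact Nat.succ_le_succ ((MvPolynomial.le_totalDegree m.2).trans hE)
  have h2 := Finset.sum_le_card_nsmul Finset.univ _ _ fun m _ => h1 m
  have h3 : (gate none).inputs.card = g.support.card := by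
    simp only [gate, CircuitGate.inputs, Multiset.card_map, Finset.card_val, Finset.card_univ,
      Fintype.card_coe]
  rw [h3]
  simp only [gate, CircuitGate.inputs, Multiset.card_zero, Finset.sum_const_zero, add_zero]
  simp only [Finset.card_univ, Fintype.card_coe, smul_eq_mul, gate, CircuitGate.inputs] at h2
  refine (Nat.add_le_add_left h2 _).trans ?_
  nlinarith [Nat.mul_le_mul_right (E + 2) hN]

/-- The sum-of-monomials circuit, with the number of monomials bounded through the degree. -/
theorem hasCircuit_of_totalDegree_le {σ : Type} [Fintype σ] (g : MvPolynomial σ 𝔽) {E : ℕ}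
    (hE : g.totalDegree ≤ E) :
    HasCircuit g 2 ((E + 1) ^ Fintype.card σ * (E + 2)) := by
  classical
  refine hasCircuit_of_card_support_le g ?_ hE
  calc g.support.card ≤ (Fintype.piFinset fun _ : σ => Finset.range (E + 1)).card := by
        refine Finset.card_le_card_of_injOn (fun m => (m : σ → ℕ)) (fun m hm => ?_)
          fun _ _ _ _ h => DFunLike.coe_injective h
        simp only [Finset.mem_coe, Fintype.mem_piFinset, Finset.mem_range, Nat.lt_succ_iff]
        exact fun i => (MvPolynomial.monomial_le_degreeOf i hm).trans
          ((MvPolynomial.degreeOf_le_totalDegree g i).trans hE)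
    _ = _ := by simp

/-- A linear combination of polynomials with circuits. -/
theorem HasCircuit.linearCombination {σ : Type*} {ι : Type} [Fintype ι] (γ : ι → 𝔽)
    {f : ι → MvPolynomial σ 𝔽} {Δ s : ℕ} (hf : ∀ i, HasCircuit (f i) Δ s) :
    HasCircuit (∑ i, γ i • f i) (Δ + 3) ((Fintype.card ι * 3 + 2) * (s + 2) - 2) := by
  classical
  have hg : HasCircuit (∑ i, γ i • MvPolynomial.X i : MvPolynomial ι 𝔽) 2
      (Fintype.card ι * 3) := by
    have hX : ∀ i, (γ i • MvPolynomial.X i : MvPolynomial ι 𝔽) =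
        MvPolynomial.monomial (Finsupp.single i 1) (γ i) := fun i => by
      rw [MvPolynomial.X, MvPolynomial.smul_monomial, smul_eq_mul, mul_one]
    refine hasCircuit_of_card_support_le (E := 1) _ ?_ ?_
    · refine (Finset.card_le_card (MvPolynomial.support_sum)).trans ?_
      refine Finset.card_biUnion_le.trans ((Finset.sum_le_card_nsmul _ _ 1 fun i _ => ?_).trans ?_)
      · rw [hX]
        exact (Finset.card_le_card MvPolynomial.support_monomial_subset).trans (by simp)
      · simp
    · refine MvPolynomial.totalDegree_finsetSum_le fun i _ => ?_
      rw [hX]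
      refine (MvPolynomial.totalDegree_monomial_le _ _).trans ?_
      simp
  have := hg.comp hf
  simp only [map_sum, map_smul, MvPolynomial.aeval_X] at this
  exact this.mono (by omega) le_rfl

end HasCircuit

/-! ### Degree filtrations -/

/-- `𝒟 e a` reads "`a` has degree at most `e`", for a degree that is subadditive on products. -/
structure IsDegreeFiltration {A : Type*} [CommRing A] (𝒟 : ℕ → A → Prop) : Prop where
  zero : ∀ e, 𝒟 e 0
  one : 𝒟 0 1
  add : ∀ {e a b}, 𝒟 e a → 𝒟 e b → 𝒟 e (a + b)
  neg : ∀ {e a}, 𝒟 e a → 𝒟 e (-a)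
  mul : ∀ {e e' a b}, 𝒟 e a → 𝒟 e' b → 𝒟 (e + e') (a * b)
  mono : ∀ {e e' a}, e ≤ e' → 𝒟 e a → 𝒟 e' a

namespace IsDegreeFiltration

variable {A : Type*} [CommRing A] {𝒟 : ℕ → A → Prop}

theorem sum (h : IsDegreeFiltration 𝒟) {ι : Type*} {s : Finset ι} {f : ι → A} {e : ℕ}
    (hf : ∀ i ∈ s, 𝒟 e (f i)) : 𝒟 e (∑ i ∈ s, f i) :=
  Finset.sum_induction _ _ (fun _ _ => h.add) (h.zero e) hf

theorem pow (h : IsDegreeFiltration 𝒟) {a : A} {e : ℕ} (ha : 𝒟 e a) (n : ℕ) :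
    𝒟 (n * e) (a ^ n) := by
  induction n with
  | zero => simpa using h.one
  | succ n ih => rw [pow_succ, Nat.succ_mul]; exact h.mul ih ha

theorem prod (h : IsDegreeFiltration 𝒟) {ι : Type*} {s : Finset ι} {f : ι → A} {e : ι → ℕ}
    (hf : ∀ i ∈ s, 𝒟 (e i) (f i)) : 𝒟 (∑ i ∈ s, e i) (∏ i ∈ s, f i) := by
  classical
  induction s using Finset.induction_on with
  | empty => simpa using h.one
  | insert i s hi ih =>
    rw [Finset.sum_insert hi, Finset.prod_insert hi]
    exact h.mul (hf i (Finset.mem_insert_self _ _))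
      (ih fun j hj => hf j (Finset.mem_insert_of_mem hj))

/-- The degree of the coefficients of a polynomial. -/
theorem polynomial (h : IsDegreeFiltration 𝒟) :
    IsDegreeFiltration fun e (p : Polynomial A) => ∀ n, 𝒟 e (p.coeff n) where
  zero e n := by simpa using h.zero e
  one n := by
    rw [Polynomial.coeff_one]
    split_ifs
    exacts [h.one, h.zero 0]
  add ha hb n := by rw [Polynomial.coeff_add]; exact h.add (ha n) (hb n)
  neg ha n := by rw [Polynomial.coeff_neg]; exact h.neg (ha n)
  mul ha hb n := by
    rw [Polynomial.coeff_mul]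
    exact h.sum fun i _ => h.mul (ha _) (hb _)
  mono he ha n := h.mono he (ha n)

theorem scale (h : IsDegreeFiltration 𝒟) (c : ℕ) : IsDegreeFiltration fun e => 𝒟 (e * c) where
  zero e := h.zero _
  one := by simpa using h.one
  add := h.add
  neg := h.neg
  mul ha hb := by rw [add_mul]; exact h.mul ha hb
  mono he := h.mono (Nat.mul_le_mul_right c he)

theorem totalDegree (σ : Type*) :
    IsDegreeFiltration fun e (p : MvPolynomial σ A) => p.totalDegree ≤ e where
  zero e := by simp
  one := by simp
  add ha hb := (MvPolynomial.totalDegree_add _ _).trans (max_le ha hb)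
  neg ha := by rwa [MvPolynomial.totalDegree_neg]
  mul ha hb := (MvPolynomial.totalDegree_mul _ _).trans (add_le_add ha hb)
  mono he ha := ha.trans he

theorem natDegree : IsDegreeFiltration fun e (p : Polynomial A) => p.natDegree ≤ e where
  zero e := by simp
  one := by simp
  add ha hb := Polynomial.natDegree_add_le_of_degree_le ha hb
  neg ha := by rwa [Polynomial.natDegree_neg]
  mul ha hb := Polynomial.natDegree_mul_le_of_le ha hb
  mono he ha := ha.trans he

theorem aeval {K : Type*} [Field K] [Algebra K A] (h : IsDegreeFiltration 𝒟)
    (hK : ∀ c : K, 𝒟 0 (algebraMap K A c)) {σ : Type*} {f : σ → A} (hf : ∀ i, 𝒟 1 (f i))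
    (p : MvPolynomial σ K) : 𝒟 p.totalDegree (MvPolynomial.aeval f p) := by
  rw [MvPolynomial.aeval_def, MvPolynomial.eval₂_eq]
  refine h.sum fun m hm => h.mono (MvPolynomial.le_totalDegree hm) ?_
  rw [← zero_add (m.sum _)]
  refine h.mul (hK _) (h.prod fun i _ => ?_)
  simpa using h.pow (hf i) (m i)

end IsDegreeFiltration

/-! ### Universal Newton iteration -/

open Polynomial in
/-- Replacing the coefficients of `G` and the powers of the argument beyond `ℓ` does not change the
value of `G` at a polynomial without constant term modulo `X ^ (ℓ + 1)`. -/
theorem X_pow_dvd_eval_sub_sum {B : Type*} [CommRing B] (ℓ : ℕ) (G : B[X][X]) (h : B[X])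
    (hh : X ∣ h) :
    X ^ (ℓ + 1) ∣ G.eval h - ∑ j : Fin (ℓ + 1),
      (∑ d : Fin (ℓ + 1), monomial (d : ℕ) ((G.coeff j).coeff d)) * h ^ (j : ℕ) := by
  rw [eval_eq_sum_range' (n := (ℓ + 1) + (G.natDegree + 1)) (by omega), Finset.sum_range_add,
    add_sub_right_comm]
  refine dvd_add ?_ (Finset.dvd_sum fun j _ => ?_)
  · rw [Finset.sum_range, ← Finset.sum_sub_distrib]
    refine Finset.dvd_sum fun j _ => ?_
    rw [← sub_mul]
    refine Dvd.dvd.mul_right ?_ _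
    rw [X_pow_dvd_iff]
    intro d hd
    rw [coeff_sub, finsetSum_coeff, Finset.sum_eq_single (⟨d, hd⟩ : Fin (ℓ + 1))]
    · simp
    · intro b _ hb
      rw [coeff_monomial, if_neg]
      exact fun h => hb (Fin.ext h)
    · simp
  · refine Dvd.dvd.mul_left ?_ _
    exact (pow_dvd_pow X (Nat.le_add_right _ _)).trans (pow_dvd_pow_of_dvd hh _)

open Polynomial in
/-- Newton iteration, with the derivative evaluated at the initial point only, for a generic
polynomial `∑ⱼ (∑_d x_{j,d} ε ^ d) V ^ j` in `V`; the variable `none` stands for the inverse of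
`x_{1,0}`.  The `i`-th iterate is the root that vanishes at `ε = 0`, up to order `ε ^ i`. -/
noncomputable def newtonIter (K : Type*) [Field K] (ℓ : ℕ) :
    ℕ → (MvPolynomial (Option (Fin (ℓ + 1) × Fin (ℓ + 1))) K)[X]
  | 0 => 0
  | i + 1 => newtonIter K ℓ i - monomial (i + 1) (MvPolynomial.X none *
      (∑ j : Fin (ℓ + 1), (∑ d : Fin (ℓ + 1), monomial (d : ℕ) (MvPolynomial.X (some (j, d)))) *
        newtonIter K ℓ i ^ (j : ℕ)).coeff (i + 1))

/-- The values of the variables of `newtonIter` for a specific polynomial `G` in `V` over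
`B[ε]`. -/
noncomputable def newtonPoint {B : Type*} [CommRing B] (ℓ : ℕ) (G : Polynomial (Polynomial B))
    (u : B) :
    Option (Fin (ℓ + 1) × Fin (ℓ + 1)) → B
  | none => u
  | some (j, d) => (G.coeff j).coeff d

open Polynomial in
theorem X_dvd_newtonIter (K : Type*) [Field K] (ℓ i : ℕ) : X ∣ newtonIter K ℓ i := by
  induction i with
  | zero => simp [newtonIter]
  | succ i ih =>
    refine dvd_sub ih ?_
    rw [X_dvd_iff, coeff_monomial, if_neg (Nat.succ_ne_zero i)]

open Polynomial in
theorem totalDegree_coeff_newtonIter_le (K : Type*) [Field K] (ℓ i n : ℕ) :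
    ((newtonIter K ℓ i).coeff n).totalDegree ≤ (ℓ + 2) ^ i := by
  have hF := IsDegreeFiltration.totalDegree (A := K) (Option (Fin (ℓ + 1) × Fin (ℓ + 1)))
  have hP := hF.polynomial
  induction i generalizing n with
  | zero => simp [newtonIter]
  | succ i ih =>
    have h1 : 1 ≤ (ℓ + 2) ^ i := Nat.one_le_pow _ _ (by omega)
    have hp : (ℓ + 2) ^ (i + 1) = ℓ * (ℓ + 2) ^ i + 2 * (ℓ + 2) ^ i := by ring
    have hX : ∀ v : Option (Fin (ℓ + 1) × Fin (ℓ + 1)),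
        (MvPolynomial.X v : MvPolynomial _ K).totalDegree ≤ 1 := fun v =>
      (MvPolynomial.totalDegree_X v).le
    rw [newtonIter, coeff_sub, sub_eq_add_neg]
    refine hF.add (hF.mono (by rw [hp]; omega) (ih n)) (hF.neg ?_)
    rw [coeff_monomial]
    split_ifs
    swap
    · exact hF.zero _
    refine hF.mono (e := 1 + (1 + ℓ * (ℓ + 2) ^ i)) (by rw [hp]; omega) (hF.mul (hX _) ?_)
    refine hP.sum (fun j _ => ?_) _
    refine hP.mono (e := 1 + j * (ℓ + 2) ^ i) ?_ (hP.mul (hP.sum fun d _ m => ?_) (hP.pow ih j))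
    · have := Nat.mul_le_mul_right ((ℓ + 2) ^ i) (Nat.lt_succ_iff.1 j.2)
      omega
    · rw [coeff_monomial]
      split_ifs
      exacts [hX _, hF.zero _]

open Polynomial in
/-- A root of `G` that vanishes at `ε = 0` is, up to order `ε ^ i`, the specialization of the
universal Newton iterate. -/
theorem X_pow_dvd_sub_newtonIter {K B : Type*} [Field K] [CommRing B] [Algebra K B] {ℓ : ℕ}
    {G : B[X][X]} {f : B[X]} {u : B} (hf : X ∣ f) (hG : G.eval f = 0)
    (hu : u * (G.coeff 1).coeff 0 = 1) {i : ℕ} (hi : i ≤ ℓ) :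
    X ^ (i + 1) ∣ f - (newtonIter K ℓ i).map
      (MvPolynomial.aeval (R := K) (newtonPoint ℓ G u)).toRingHom := by
  induction i with
  | zero => simpa [newtonIter] using hf
  | succ i ih =>
    specialize ih (by omega)
    set F := (MvPolynomial.aeval (R := K) (newtonPoint ℓ G u)).toRingHom with hFdef
    set g := (newtonIter K ℓ i).map F with hg
    have hXg : X ∣ g := by
      obtain ⟨r, hr⟩ := X_dvd_newtonIter K ℓ i
      exact ⟨r.map F, by rw [hg, hr, Polynomial.map_mul, map_X]⟩
    obtain ⟨h, hh⟩ := ih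
    have hfg : f = g + X ^ (i + 1) * h := by rw [← hh]; ring
    -- the correction term of the iteration, specialized
    have hstep : (newtonIter K ℓ (i + 1)).map F =
        g - monomial (i + 1) (u * (G.eval g).coeff (i + 1)) := by
      have hd := X_pow_dvd_eval_sub_sum ℓ G g hXg
      rw [X_pow_dvd_iff] at hd
      have hc := hd (i + 1) (by omega)
      rw [coeff_sub, sub_eq_zero] at hc
      rw [newtonIter, Polynomial.map_sub, map_monomial, map_mul, ← coeff_map, hc]
      have hn : F (MvPolynomial.X none) = u := by simp [hFdef, newtonPoint]
      have hs : ∀ j d, F (MvPolynomial.X (some (j, d))) = (G.coeff j).coeff d := by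
        simp [hFdef, newtonPoint]
      rw [hn, Polynomial.map_sum]
      simp only [Polynomial.map_mul, Polynomial.map_sum, map_monomial, hs, Polynomial.map_pow]
      rfl
    obtain ⟨r, hr⟩ := G.binomExpansion g (X ^ (i + 1) * h)
    rw [← hfg, hG] at hr
    have h0 : (eval g (derivative G)).coeff 0 = (G.coeff 1).coeff 0 := by
      obtain ⟨g', hg'⟩ := hXg
      rw [coeff_zero_eq_eval_zero, ← coe_evalRingHom, ← eval₂_hom]
      simp only [coe_evalRingHom, hg', eval_mul, eval_X, zero_mul, eval₂_at_zero]
      rw [← coeff_zero_eq_eval_zero, coeff_derivative]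
      simp
    have hcoef : (G.eval g).coeff (i + 1) + (G.coeff 1).coeff 0 * h.coeff 0 = 0 := by
      have := congrArg (fun p => p.coeff (i + 1)) hr
      simp only [coeff_zero, coeff_add] at this
      rw [show eval g (derivative G) * (X ^ (i + 1) * h) =
        X ^ (i + 1) * (eval g (derivative G) * h) by ring,
        show r * (X ^ (i + 1) * h) ^ 2 = X ^ (i + 1) * (X * (X ^ i * h ^ 2 * r)) by ring,
        coeff_X_pow_mul', coeff_X_pow_mul'] at this
      simp only [le_refl, if_true, Nat.sub_self, mul_coeff_zero, h0, coeff_X_zero, zero_mul,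
        add_zero] at this
      exact this.symm
    have hh0 : h.coeff 0 = - (u * (G.eval g).coeff (i + 1)) := by
      linear_combination (-h.coeff 0) * hu + u * hcoef
    rw [hstep, hfg]
    have hX : X ∣ h - C (h.coeff 0) := by
      rw [X_dvd_iff, coeff_sub, coeff_C_zero, sub_self]
    obtain ⟨t, ht⟩ := hX
    refine ⟨t, ?_⟩
    rw [← neg_neg (u * _), ← hh0, ← C_mul_X_pow_eq_monomial, C_neg, pow_succ X (i + 1), mul_assoc,
      ← ht]
    ring

/-! ### Interpolation -/

/-- Lagrange interpolation at the nodes `0, …, N`: the inverse of a Vandermonde matrix. -/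
theorem exists_interpolation_coeff (K : Type*) [Field K] [CharZero K] (N : ℕ) :
    ∃ c : Fin (N + 1) → Fin (N + 1) → K, ∀ i j : Fin (N + 1),
      ∑ r, c i r * ((r : ℕ) : K) ^ (j : ℕ) = if i = j then 1 else 0 := by
  set V := Matrix.vandermonde fun r : Fin (N + 1) => ((r : ℕ) : K)
  have hV : IsUnit V.det := by
    rw [isUnit_iff_ne_zero, Matrix.det_vandermonde_ne_zero_iff]
    exact fun a b h => Fin.ext (Nat.cast_injective h)
  refine ⟨fun i r => Inv.inv (α := Matrix (Fin (N + 1)) (Fin (N + 1)) K) V i r, fun i j => ?_⟩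
  have := congrFun (congrFun (Matrix.nonsing_inv_mul V hV) i) j
  rw [Matrix.mul_apply, Matrix.one_apply] at this
  simpa [V, Matrix.vandermonde_apply] using this

/-- A linear functional on polynomials over `A` whose values on monomials lie in the field `K` is,
on polynomials of bounded degree, a `K`-linear combination of evaluations at points of a grid. -/
theorem exists_interpolation {K A : Type*} [Field K] [CharZero K] [CommRing A] [Algebra K A]
    {ν : ℕ} (N : ℕ) (L : MvPolynomial (Fin ν) A →ₗ[A] A) (c : (Fin ν →₀ ℕ) → K)
    (hL : ∀ m, L (MvPolynomial.monomial m 1) = algebraMap K A (c m)) :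
    ∃ γ : (Fin ν → Fin (N + 1)) → K, ∀ p : MvPolynomial (Fin ν) A, p.totalDegree ≤ N →
      L p = ∑ r, γ r • MvPolynomial.eval (fun i => algebraMap K A ((r i : ℕ) : K)) p := by
  classical
  obtain ⟨b, hb⟩ := exists_interpolation_coeff K N
  refine ⟨fun r => ∑ m : Fin ν → Fin (N + 1),
    c (Finsupp.equivFunOnFinite.symm fun i => (m i : ℕ)) * ∏ i, b (m i) (r i), fun p hp => ?_⟩
  have key : ∀ m : Fin ν →₀ ℕ, (∀ i, m i ≤ N) →
      ∑ r : Fin ν → Fin (N + 1), (∑ m : Fin ν → Fin (N + 1),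
        c (Finsupp.equivFunOnFinite.symm fun i => (m i : ℕ)) * ∏ i, b (m i) (r i)) *
        ∏ i, ((r i : ℕ) : K) ^ m i = c m := by
    intro m hm
    simp only [Finset.sum_mul]
    rw [Finset.sum_comm]
    simp only [mul_assoc, ← Finset.prod_mul_distrib, ← Finset.mul_sum]
    let m' : Fin ν → Fin (N + 1) := fun i => ⟨m i, Nat.lt_succ_of_le (hm i)⟩
    have hsum : ∀ x : Fin ν → Fin (N + 1), ∑ r : Fin ν → Fin (N + 1),
        ∏ i, b (x i) (r i) * ((r i : ℕ) : K) ^ m i = if x = m' then 1 else 0 := by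
      intro x
      rw [← Fintype.piFinset_univ, ← Finset.prod_univ_sum (fun _ => Finset.univ)
        fun i r => b (x i) r * ((r : ℕ) : K) ^ m i]
      have := fun i => hb (x i) (m' i)
      simp only [m'] at this
      simp only [this]
      rw [Finset.prod_ite_zero]
      simp [funext_iff, m']
    simp only [hsum, mul_ite, mul_one, mul_zero, Finset.sum_ite_eq', Finset.mem_univ, if_true]
    congr 1
    ext i
    rfl
  conv_lhs => rw [p.as_sum]
  simp only [MvPolynomial.eval_eq', map_sum]
  simp only [Finset.smul_sum]
  rw [Finset.sum_comm]
  refine Finset.sum_congr rfl fun m hm => ?_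
  have hmN : ∀ i, m i ≤ N := fun i => (MvPolynomial.monomial_le_degreeOf i hm).trans
    ((MvPolynomial.degreeOf_le_totalDegree p i).trans hp)
  have h1 : MvPolynomial.monomial m (p.coeff m) =
      p.coeff m • MvPolynomial.monomial m (1 : A) := by
    rw [MvPolynomial.smul_monomial, smul_eq_mul, mul_one]
  rw [h1, map_smul, hL, ← key m hmN, smul_eq_mul, map_sum, Finset.mul_sum]
  refine Finset.sum_congr rfl fun r _ => ?_
  rw [map_mul, map_prod, Algebra.smul_def]
  simp only [map_pow]
  ring

/-! ### The approximate root as a polynomial in `T` over `𝔽[w][y]` -/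

/-- The point with coordinates `t, w, y, z` of an algebra. -/
def pointTXZ {A : Type*} {n : ℕ} (t : A) (w : Fin n → A) (y z : A) : VarTXZ (VarWY n) → A
  | .T => t
  | .x (.w i) => w i
  | .x .y => y
  | .z => z

/-- The point with coordinates `t, w, y` of an algebra. -/
def pointTX {A : Type*} {n : ℕ} (t : A) (w : Fin n → A) (y : A) : VarTX (VarWY n) → A
  | .T => t
  | .x (.w i) => w i
  | .x .y => y

section Evaluation

variable {K A B : Type*} [Field K] [CommRing A] [Algebra K A] [CommRing B] [Algebra K B] {n : ℕ}

theorem comp_pointTXZ {A B : Type*} {n : ℕ} (g : A → B) (t : A) (w : Fin n → A) (y z : A) :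
    (fun v => g (pointTXZ t w y z v)) = pointTXZ (g t) (fun i => g (w i)) (g y) (g z) := by
  funext v
  rcases v with _ | (_ | _) | _ <;> rfl

theorem map_aeval_pointTXZ (g : A →ₐ[K] B) (t : A) (w : Fin n → A) (y z : A)
    (P : MvPolynomial (VarTXZ (VarWY n)) K) :
    g (MvPolynomial.aeval (pointTXZ t w y z) P) =
      MvPolynomial.aeval (pointTXZ (g t) (fun i => g (w i)) (g y) (g z)) P := by
  rw [← comp_pointTXZ]
  exact MvPolynomial.comp_aeval_apply _ g P

theorem map_substZ (h : MvPolynomial (VarTX (VarWY n)) K →ₐ[K] A)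
    (P : MvPolynomial (VarTXZ (VarWY n)) K) (R : MvPolynomial (VarTX (VarWY n)) K) :
    h (substZ P R) = MvPolynomial.aeval (pointTXZ (h (MvPolynomial.X VarTX.T))
      (fun i => h (MvPolynomial.X (VarTX.x (VarWY.w i)))) (h (MvPolynomial.X (VarTX.x VarWY.y)))
      (h R)) P := by
  refine (MvPolynomial.comp_aeval_apply _ h P).trans ?_
  refine congrArg (fun f => MvPolynomial.aeval f P) ?_
  funext v
  rcases v with _ | (_ | _) | _ <;> rfl

/-- The polynomial `P(0, 0, 0, z)`; for a `T`-regularized `P` it is `P(0, w, y, z)`. -/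
noncomputable def fiberPoly (P : MvPolynomial (VarTXZ (VarWY n)) K) : Polynomial K :=
  MvPolynomial.aeval (pointTXZ 0 (fun _ => 0) 0 Polynomial.X) P

theorem aeval_pointTXZ_zero {P : MvPolynomial (VarTXZ (VarWY n)) K} (hP : IsTRegularized P)
    (w : Fin n → A) (y z : A) :
    MvPolynomial.aeval (pointTXZ 0 w y z) P = Polynomial.aeval z (fiberPoly P) := by
  rw [fiberPoly, map_aeval_pointTXZ]
  simp only [map_zero, Polynomial.aeval_X]
  rw [MvPolynomial.aeval_def, MvPolynomial.aeval_def, MvPolynomial.eval₂_eq, MvPolynomial.eval₂_eq]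
  refine Finset.sum_congr rfl fun m hm => ?_
  congr 1
  by_cases hx : ∃ i, m (VarTXZ.x i) ≠ 0
  · have hT := hP m hm hx
    rw [Finset.prod_eq_zero (Finsupp.mem_support_iff.2 hT),
      Finset.prod_eq_zero (Finsupp.mem_support_iff.2 hT)] <;> simp [pointTXZ, hT]
  · push Not at hx
    refine Finset.prod_congr rfl fun i hi => ?_
    rcases i with _ | i | _
    · rfl
    · exact absurd (hx i) (Finsupp.mem_support_iff.1 hi)
    · rfl

theorem derivative_fiberPoly (P : MvPolynomial (VarTXZ (VarWY n)) K) :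
    Polynomial.derivative (fiberPoly P) = fiberPoly (MvPolynomial.pderiv VarTXZ.z P) := by
  classical
  unfold fiberPoly
  induction P using MvPolynomial.induction_on with
  | C a => simp
  | add p q hp hq => simp [hp, hq]
  | mul_X p v hp =>
    rw [map_mul, Polynomial.derivative_mul, hp, Derivation.leibniz, map_add, smul_eq_mul,
      smul_eq_mul, map_mul, map_mul, MvPolynomial.aeval_X, MvPolynomial.pderiv_X]
    have : Polynomial.derivative (pointTXZ 0 (fun _ => 0) 0 (Polynomial.X : Polynomial K) v) =
        MvPolynomial.aeval (pointTXZ 0 (fun _ : Fin n => 0) 0 (Polynomial.X : Polynomial K))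
          (Pi.single (M := fun _ => MvPolynomial (VarTXZ (VarWY n)) K) VarTXZ.z 1 v) := by
      rcases v with _ | (_ | _) | _ <;> simp [pointTXZ]
    rw [this]
    ring

/-- A root in a domain of a polynomial over a field that specializes to a simple root is
constant. -/
theorem eq_algebraMap_of_simple_root [IsDomain A] {p : Polynomial K} {r : A} (g : A →ₐ[K] K)
    (hr : Polynomial.aeval r p = 0) (hs : (Polynomial.derivative p).eval (g r) ≠ 0) :
    r = algebraMap K A (g r) := by
  have h0 : p.eval (g r) = 0 := by
    rw [← Polynomial.coe_aeval_eq_eval, Polynomial.aeval_algHom_apply, hr, map_zero]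
  obtain ⟨q, hq⟩ := Polynomial.dvd_iff_isRoot.2 h0
  have hq0 : q.eval (g r) ≠ 0 := by
    rw [hq] at hs
    simpa using hs
  rw [hq, map_mul, mul_eq_zero] at hr
  rcases hr with hr | hr
  · simpa [sub_eq_zero] using hr
  · refine absurd ?_ hq0
    rw [← Polynomial.coe_aeval_eq_eval, Polynomial.aeval_algHom_apply, hr, map_zero]

end Evaluation

section PolynomialInT

variable {K : Type*} [Field K] {n : ℕ}

open Polynomial

/-- The ring `𝔽[T, w, y]` viewed as `𝔽[w][y][T]`. -/
noncomputable def toPolyT (K : Type*) [Field K] (n : ℕ) :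
    MvPolynomial (VarTX (VarWY n)) K →ₐ[K] (MvPolynomial (Fin n) K)[X][X] :=
  MvPolynomial.aeval (pointTX X (fun i => C (C (MvPolynomial.X i))) (C X))

theorem toPolyT_injective : Function.Injective (toPolyT K n) := by
  let g : (MvPolynomial (Fin n) K)[X][X] →+* MvPolynomial (VarTX (VarWY n)) K :=
    eval₂RingHom (eval₂RingHom (MvPolynomial.aeval (R := K) fun i =>
      MvPolynomial.X (VarTX.x (VarWY.w i))).toRingHom
      (MvPolynomial.X (VarTX.x VarWY.y))) (MvPolynomial.X VarTX.T)
  have h : g.comp (toPolyT K n).toRingHom = RingHom.id _ := by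
    refine MvPolynomial.ringHom_ext (fun a => ?_) fun v => ?_
    · simp [g, toPolyT, Polynomial.algebraMap_apply, MvPolynomial.algebraMap_eq]
    · rcases v with _ | (_ | _) <;> simp [g, toPolyT, pointTX]
  exact Function.LeftInverse.injective (g := g) fun x => congrArg (fun f => f x) h

theorem toPolyT_substZ (P : MvPolynomial (VarTXZ (VarWY n)) K)
    (R : MvPolynomial (VarTX (VarWY n)) K) :
    toPolyT K n (substZ P R) = MvPolynomial.aeval
      (pointTXZ X (fun i => C (C (MvPolynomial.X i))) (C X) (toPolyT K n R)) P := by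
  have := map_substZ (A := (MvPolynomial (Fin n) K)[X][X]) (toPolyT K n) P R
  simpa [toPolyT, pointTX] using this

theorem toPolyT_ySub (F : MvPolynomial (Fin n) K) :
    toPolyT K n (ySub F) = C (X - C F) := by
  have : ∀ F : MvPolynomial (Fin n) K,
      toPolyT K n (MvPolynomial.rename (fun i => VarTX.x (VarWY.w i)) F) = C (C F) := by
    intro F
    induction F using MvPolynomial.induction_on with
    | C a => simp [toPolyT, Polynomial.algebraMap_apply, MvPolynomial.algebraMap_eq]
    | add p q hp hq => simp [hp, hq]
    | mul_X p v hp =>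
      rw [map_mul, map_mul, hp, MvPolynomial.rename_X]
      simp [toPolyT, pointTX]
  rw [ySub, map_sub, this, C_sub]
  simp [toPolyT, pointTX]

theorem natDegree_toPolyT_le (R : MvPolynomial (VarTX (VarWY n)) K) :
    (toPolyT K n R).natDegree ≤ R.degreeOf VarTX.T := by
  classical
  rw [toPolyT, MvPolynomial.aeval_def, MvPolynomial.eval₂_eq]
  refine natDegree_sum_le_of_forall_le _ _ fun m hm => ?_
  refine le_trans ?_ (MvPolynomial.monomial_le_degreeOf VarTX.T hm)
  rw [Polynomial.algebraMap_apply]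
  refine (natDegree_C_mul_le _ _).trans ((natDegree_prod_le _ _).trans ?_)
  calc _ ≤ ∑ i ∈ m.support, if i = VarTX.T then m VarTX.T else 0 := by
        refine Finset.sum_le_sum fun i _ => ?_
        rcases i with _ | (_ | _)
        · simp [pointTX]
        · simp only [pointTX, ← C_pow, natDegree_C, Nat.zero_le]
        · simp only [pointTX, ← C_pow, natDegree_C, Nat.zero_le]
    _ ≤ _ := by
        rw [Finset.sum_ite_eq']
        split_ifs <;> simp

/-- The first nonzero coefficient of `P(T, w, y, r)` in `T` is, up to a constant, the coefficient
at the same power `T ^ m` of a root of `P` modulo `T ^ (m + 1)`: the truncated `r` has no such term,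
and one Newton step at order `m` supplies it. -/
theorem exists_newton_step {A : Type*} [CommRing A] [IsDomain A] [Algebra K A] {k : ℕ}
    {P : MvPolynomial (VarTXZ (VarWY n)) K} (hreg : IsTRegularized P) (w : Fin n → A) (y : A)
    (g : A →ₐ[K] K) {r Q : A[X]}
    (hQ : MvPolynomial.aeval (pointTXZ X (fun i => C (w i)) (C y) r) P = Q)
    (hk : 1 < k) (hQ0 : Q ≠ 0) (hQk : X ^ k ∣ Q) (hrk : r.natDegree < k)
    (hsimple : (derivative (fiberPoly P)).eval (g (r.coeff 0)) ≠ 0) :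
    ∃ (m : ℕ) (φ : A[X]) (c : A), c ≠ 0 ∧ Q.coeff m ≠ 0 ∧
      X ^ (m + 1) ∣ MvPolynomial.aeval (pointTXZ X (fun i => C (w i)) (C y) φ) P ∧
      φ.coeff 0 = algebraMap K A (g (r.coeff 0)) ∧ φ.coeff m = c * Q.coeff m := by
  -- `P` as a polynomial in `z`
  set Pz : A[X][X] :=
    MvPolynomial.aeval (pointTXZ (C X) (fun i => C (C (w i))) (C (C y)) X) P with hPz
  have hPzeval : ∀ s, Pz.eval s =
      MvPolynomial.aeval (pointTXZ X (fun i => C (w i)) (C y) s) P := by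
    intro s
    have := map_aeval_pointTXZ ((aeval (R := A[X]) s).restrictScalars K)
      (C X) (fun i => C (C (w i))) (C (C y)) X P
    simpa [hPz, coe_aeval_eq_eval] using this
  have hQ' : Pz.eval r = Q := by rw [hPzeval, hQ]
  -- reduction modulo `T`
  let c0 : A[X] →ₐ[K] A := (aeval (R := A) 0).restrictScalars K
  have hc0 : ∀ p, c0 p = p.coeff 0 := fun p => by simp [c0, coeff_zero_eq_aeval_zero]
  have hzero : ∀ s : A[X], (Pz.eval s).coeff 0 = aeval (s.coeff 0) (fiberPoly P) := by
    intro s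
    rw [hPzeval, ← hc0, map_aeval_pointTXZ, ← hc0 s, ← aeval_pointTXZ_zero hreg w y]
    simp [hc0]
  set α := g (r.coeff 0) with hα
  set β := (derivative (fiberPoly P)).eval α with hβ
  have hr0 : r.coeff 0 = algebraMap K _ α := by
    refine eq_algebraMap_of_simple_root (p := fiberPoly P) g ?_ hsimple
    rw [← hzero, hQ']
    exact X_pow_dvd_iff.1 hQk 0 (by omega)
  have hder : ((derivative Pz).eval r).coeff 0 = algebraMap K _ β := by
    have hmap : Pz.map c0.toRingHom = (fiberPoly P).map (algebraMap K A) := by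
      have h1 := map_aeval_pointTXZ (Polynomial.mapAlgHom c0)
        (C X) (fun i => C (C (w i))) (C (C y)) X P
      have h2 := aeval_pointTXZ_zero (A := A[X]) hreg (fun i => C (w i)) (C y) X
      rw [aeval_X_left_eq_map] at h2
      rw [← h2]
      simpa [hPz, hc0] using h1
    have h4 : ((derivative Pz).eval r).coeff 0 =
        (derivative (Pz.map c0.toRingHom)).eval (r.coeff 0) := by
      rw [derivative_map, eval_map, ← hc0, ← hc0]
      exact hom_eval₂ (derivative Pz) (RingHom.id _) c0.toRingHom r
    rw [h4, hmap, hr0, derivative_map, eval_map_algebraMap, aeval_algebraMap_apply]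
    rfl
  -- the lowest coefficient of `Q`
  set m := Q.natTrailingDegree with hm
  have hkm : k ≤ m := by
    rw [hm]
    refine le_natTrailingDegree hQ0 fun i hi => X_pow_dvd_iff.1 hQk i hi
  have hq0 : Q.coeff m ≠ 0 := by
    rw [hm]
    exact mt trailingCoeff_eq_zero.1 hQ0
  have hβ0 : algebraMap K A β⁻¹ ≠ 0 := by
    rw [Ne, map_eq_zero_iff _ (algebraMap K A).injective]
    exact inv_ne_zero hsimple
  set h : A[X] := monomial m (-algebraMap K _ β⁻¹ * Q.coeff m) with hh
  have hrm : r.coeff m = 0 := coeff_eq_zero_of_natDegree_lt (hrk.trans_le hkm)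
  refine ⟨m, r + h, -algebraMap K _ β⁻¹, neg_ne_zero.2 hβ0, hq0, ?_, ?_, ?_⟩
  · obtain ⟨t, ht⟩ := Pz.binomExpansion r h
    rw [← hPzeval, ht, hQ']
    refine dvd_add ?_ ?_
    · rw [X_pow_dvd_iff]
      intro i hi
      rw [hh, ← C_mul_X_pow_eq_monomial, ← mul_assoc, coeff_add, coeff_mul_X_pow']
      rcases (Nat.lt_succ_iff.1 hi).lt_or_eq with hlt | rfl
      · rw [if_neg (by omega), add_zero]
        exact coeff_eq_zero_of_lt_natTrailingDegree hlt
      · rw [if_pos le_rfl, Nat.sub_self, coeff_mul_C, hder, ← mul_assoc, mul_neg, ← map_mul,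
          mul_inv_cancel₀ hsimple, map_one, neg_one_mul, add_neg_cancel]
    · refine Dvd.dvd.mul_left ?_ _
      rw [hh, ← C_mul_X_pow_eq_monomial, mul_pow, ← pow_mul]
      exact Dvd.dvd.mul_left (pow_dvd_pow X (by omega)) _
  · rw [coeff_add, hr0, hh, coeff_monomial, if_neg (by omega), add_zero]
  · rw [coeff_add, hrm, hh, coeff_monomial, if_pos rfl, zero_add]

/-- The polynomial `y - F` divides a coefficient, at some `T ^ m`, of a root of `P` modulo
`T ^ (m + 1)` whose value at `T = 0` is a simple root of `P(0, w, y, z)`. -/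
theorem exists_root_mod_X_pow {k : ℕ} {P : MvPolynomial (VarTXZ (VarWY n)) K}
    {R : MvPolynomial (VarTX (VarWY n)) K} {F : MvPolynomial (Fin n) K}
    (hk : 1 < k) (hreg : IsTRegularized P) (hroot : IsApproxRoot P R k) (htr : IsTruncated R k)
    (hnd : IsNondegenerate P R) (hne : substZ P R ≠ 0) (hF : ySub F ∣ substZ P R) :
    ∃ (m : ℕ) (α : K) (φ : (MvPolynomial (Fin n) K)[X][X]),
      X ^ (m + 1) ∣ MvPolynomial.aeval
        (pointTXZ X (fun i => C (C (MvPolynomial.X i))) (C X) φ) P ∧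
      φ.coeff 0 = algebraMap K _ α ∧ (derivative (fiberPoly P)).eval α ≠ 0 ∧
      φ.coeff m ≠ 0 ∧ X - C F ∣ φ.coeff m := by
  let g : (MvPolynomial (Fin n) K)[X] →ₐ[K] K :=
    (MvPolynomial.aeval (R := K) (fun _ : Fin n => (0 : K))).comp
      ((aeval (R := MvPolynomial (Fin n) K) (0 : MvPolynomial (Fin n) K)).restrictScalars K)
  have hgα : g ((toPolyT K n R).coeff 0) = MvPolynomial.aeval (fun _ => (0 : K)) R := by
    let g' : (MvPolynomial (Fin n) K)[X][X] →ₐ[K] K :=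
      g.comp ((aeval (R := (MvPolynomial (Fin n) K)[X]) 0).restrictScalars K)
    have h2 : g'.comp (toPolyT K n) = MvPolynomial.aeval fun _ => (0 : K) := by
      refine MvPolynomial.algHom_ext fun v => ?_
      rcases v with _ | (_ | _) <;> simp [g', g, toPolyT, pointTX]
    rw [← h2]
    simp [g', coeff_zero_eq_aeval_zero]
  have hsimple : (derivative (fiberPoly P)).eval (g ((toPolyT K n R).coeff 0)) ≠ 0 := by
    rw [hgα, derivative_fiberPoly, fiberPoly, ← coe_aeval_eq_eval, map_aeval_pointTXZ]
    simp only [map_zero, aeval_X, MvPolynomial.aeval_eq_eval]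
    refine fun h => hnd (Eq.trans (congrArg
      (fun f => MvPolynomial.eval f (MvPolynomial.pderiv VarTXZ.z P)) ?_) h)
    funext v
    rcases v with _ | (_ | _) | _ <;> rfl
  have hQ0 : toPolyT K n (substZ P R) ≠ 0 := by
    rw [Ne, map_eq_zero_iff _ toPolyT_injective]
    exact hne
  have hQk : X ^ k ∣ toPolyT K n (substZ P R) := by
    obtain ⟨q, hq⟩ := hroot
    refine ⟨toPolyT K n q, ?_⟩
    rw [hq, map_mul, map_pow]
    simp [toPolyT, pointTX]
  have hQF : C (X - C F) ∣ toPolyT K n (substZ P R) := by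
    rw [← toPolyT_ySub]
    obtain ⟨q, hq⟩ := hF
    exact ⟨toPolyT K n q, by rw [hq, map_mul]⟩
  obtain ⟨m, φ, c, hc, hQm, h1, h2, h3⟩ := exists_newton_step hreg
    (fun i => C (MvPolynomial.X i)) X g (toPolyT_substZ P R).symm hk hQ0 hQk
    ((natDegree_toPolyT_le R).trans_lt htr) hsimple
  refine ⟨m, _, φ, h1, h2, hsimple, ?_, ?_⟩
  · rw [h3]
    exact mul_ne_zero hc hQm
  · rw [h3]
    exact Dvd.dvd.mul_left ((C_dvd_iff_dvd_coeff _ _).1 hQF m) _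

/-- A suitable derivative of a nonzero polynomial turns a multiple root into a simple one. -/
theorem exists_iterate_derivative_simple_root {A : Type*} [CommRing A] [IsDomain A] [CharZero A]
    {Φ : A[X]} {F : A} (hΦ : Φ ≠ 0) (hF : X - C F ∣ Φ) :
    ∃ e : ℕ, (derivative^[e] Φ).eval F = 0 ∧ (derivative^[e + 1] Φ).eval F ≠ 0 := by
  have hpos : 0 < Φ.rootMultiplicity F :=
    (rootMultiplicity_pos hΦ).2 (dvd_iff_isRoot.1 hF)
  refine ⟨Φ.rootMultiplicity F - 1,
    isRoot_iterate_derivative_of_lt_rootMultiplicity (by omega), ?_⟩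
  rw [Nat.sub_add_cancel hpos, eval_iterate_derivative_rootMultiplicity]
  exact smul_ne_zero (Nat.factorial_ne_zero _) (eval_divByMonic_pow_rootMultiplicity_ne_zero F hΦ)

end PolynomialInT

/-! ### Restriction to lines and expansion around a root -/

section Shift

open Polynomial

variable {K A B S : Type*} [Field K] [CommRing A] [Algebra K A] [CommRing B] [Algebra K B] {n : ℕ}

/-- The line `a + ε (w - a)` through `a` and `w`, parametrized by `ε`. -/
noncomputable def linePoly (a w : A) : A[X] := C a + X * C (w - a)

theorem map_linePoly (g : A →+* B) (a w : A) : (linePoly a w).map g = linePoly (g a) (g w) := by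
  simp [linePoly]

/-- The polynomial `P(t, a + ε (w - a), y, z + V)` in `ε` (inner variable) and `V` (outer
variable). -/
noncomputable def shiftedPoly (P : MvPolynomial (VarTXZ (VarWY n)) K) (t : A) (a w : Fin n → A)
    (y z : A) : A[X][X] :=
  MvPolynomial.aeval
    (pointTXZ (C (C t)) (fun i => C (linePoly (a i) (w i))) (C (C y)) (C (C z) + X)) P

theorem map_shiftedPoly (g : A →ₐ[K] B) (P : MvPolynomial (VarTXZ (VarWY n)) K) (t : A)
    (a w : Fin n → A) (y z : A) :
    (shiftedPoly P t a w y z).map (mapRingHom (g : A →+* B)) =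
      shiftedPoly P (g t) (fun i => g (a i)) (fun i => g (w i)) (g y) (g z) := by
  have := map_aeval_pointTXZ (mapAlgHom (mapAlgHom g)) (C (C t))
    (fun i => C (linePoly (a i) (w i))) (C (C y)) (C (C z) + X) P
  simp only [coe_mapAlgHom, Polynomial.map_add, map_C, map_X] at this
  refine Eq.trans this ?_
  simp [shiftedPoly, map_linePoly]

/-- The polynomial `P(t, a, y, z + V)` in `V`. -/
noncomputable def basePoly (P : MvPolynomial (VarTXZ (VarWY n)) K) (t : A) (a : Fin n → A)
    (y z : A) : A[X] :=
  MvPolynomial.aeval (pointTXZ (C t) (fun i => C (a i)) (C y) (C z + X)) P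

theorem map_basePoly (g : A →ₐ[K] B) (P : MvPolynomial (VarTXZ (VarWY n)) K) (t : A)
    (a : Fin n → A) (y z : A) :
    (basePoly P t a y z).map (g : A →+* B) =
      basePoly P (g t) (fun i => g (a i)) (g y) (g z) := by
  have := map_aeval_pointTXZ (mapAlgHom g) (C t) (fun i => C (a i)) (C y) (C z + X) P
  simpa [basePoly] using this

theorem coeff_zero_shiftedPoly (P : MvPolynomial (VarTXZ (VarWY n)) K) (t : A)
    (a w : Fin n → A) (y z : A) (j : ℕ) :
    ((shiftedPoly P t a w y z).coeff j).coeff 0 = (basePoly P t a y z).coeff j := by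
  let c0 : A[X] →ₐ[K] A := (aeval (R := A) 0).restrictScalars K
  have hc0 : ∀ p, c0 p = p.coeff 0 := fun p => by simp [c0, coeff_zero_eq_aeval_zero]
  have := map_aeval_pointTXZ (mapAlgHom c0) (C (C t))
    (fun i => C (linePoly (a i) (w i))) (C (C y)) (C (C z) + X) P
  have h2 := congrArg (fun p => p.coeff j) this
  simp only [coe_mapAlgHom, coeff_map, RingHom.coe_coe, hc0] at h2
  simpa [shiftedPoly, basePoly, hc0, linePoly] using h2

theorem eval_shiftedPoly (P : MvPolynomial (VarTXZ (VarWY n)) K) (t : A)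
    (a w : Fin n → A) (y z : A) (f : A[X]) :
    (shiftedPoly P t a w y z).eval f = MvPolynomial.aeval
      (pointTXZ (C t) (fun i => linePoly (a i) (w i)) (C y) (C z + f)) P := by
  have := map_aeval_pointTXZ ((aeval (R := A[X]) f).restrictScalars K) (C (C t))
    (fun i => C (linePoly (a i) (w i))) (C (C y)) (C (C z) + X) P
  simpa [shiftedPoly, coe_aeval_eq_eval] using this

/-- The derivative in `z` of a `T`-regularized `P` at a point with `T = 0`. -/
theorem coeff_one_basePoly_zero {P : MvPolynomial (VarTXZ (VarWY n)) K} (hP : IsTRegularized P)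
    (a : Fin n → A) (y : A) (α : K) :
    (basePoly P 0 a y (algebraMap K A α)).coeff 1 =
      algebraMap K A ((derivative (fiberPoly P)).eval α) := by
  have h := aeval_pointTXZ_zero (A := A[X]) hP (fun i => C (a i)) (C y)
    (C (algebraMap K A α) + X)
  have h2 : aeval (C (algebraMap K A α) + X) (fiberPoly P) =
      (taylor α (fiberPoly P)).map (algebraMap K A) := by
    rw [taylor_apply, map_comp, comp_eq_aeval, aeval_map_algebraMap]
    simp [add_comm]
  rw [basePoly, C_0, h, h2, coeff_map, taylor_coeff_one]

theorem map_newtonPoint (g : A →+* B) (ℓ : ℕ) (G : A[X][X]) (u : A)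
    (v : Option (Fin (ℓ + 1) × Fin (ℓ + 1))) :
    g (newtonPoint ℓ G u v) = newtonPoint ℓ (G.map (mapRingHom g)) (g u) v := by
  rcases v with _ | ⟨j, d⟩ <;> simp [newtonPoint]

theorem map_aeval_newtonPoint (g : A →ₐ[K] B) {ℓ : ℕ} (G : A[X][X]) (u : A)
    (W : MvPolynomial (Option (Fin (ℓ + 1) × Fin (ℓ + 1))) K) :
    g (MvPolynomial.aeval (newtonPoint ℓ G u) W) =
      MvPolynomial.aeval (newtonPoint ℓ (G.map (mapRingHom (g : A →+* B))) (g u)) W := by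
  refine (MvPolynomial.comp_aeval_apply _ g W).trans ?_
  refine congrArg (fun f => MvPolynomial.aeval f W) ?_
  funext v
  exact map_newtonPoint (g : A →+* B) ℓ G u v

/-- Newton iteration modulo an ideal. -/
theorem coeff_sub_newtonIter_mem (I : Ideal A) {ℓ : ℕ} {G : A[X][X]} {f : A[X]} {u : A}
    (hf : X ∣ f) (hG : ∀ i, (G.eval f).coeff i ∈ I) (hu : u * (G.coeff 1).coeff 0 - 1 ∈ I)
    {d : ℕ} (hd : d ≤ ℓ) :
    f.coeff d - MvPolynomial.aeval (R := K) (newtonPoint ℓ G u) ((newtonIter K ℓ ℓ).coeff d) ∈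
      I := by
  let g : A →ₐ[K] A ⧸ I := Ideal.Quotient.mkₐ K I
  have hg : ∀ x, g x = 0 ↔ x ∈ I := fun x => Ideal.Quotient.eq_zero_iff_mem
  have h1 : X ∣ f.map (g : A →+* A ⧸ I) := by
    obtain ⟨q, rfl⟩ := hf
    exact ⟨q.map _, by rw [Polynomial.map_mul, map_X]⟩
  have h2 : (G.map (mapRingHom (g : A →+* A ⧸ I))).eval (f.map (g : A →+* A ⧸ I)) = 0 := by
    have : (G.map (mapRingHom (g : A →+* A ⧸ I))).eval (f.map (g : A →+* A ⧸ I)) =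
        (G.eval f).map (g : A →+* A ⧸ I) := by
      rw [eval_map]
      exact (hom_eval₂ G (RingHom.id _) (mapRingHom (g : A →+* A ⧸ I)) f).symm
    rw [this]
    ext i
    rw [coeff_map, coeff_zero]
    exact (hg _).2 (hG i)
  have h3 : g u * ((G.map (mapRingHom (g : A →+* A ⧸ I))).coeff 1).coeff 0 = 1 := by
    have := (hg _).2 hu
    rw [map_sub, map_mul, map_one, sub_eq_zero] at this
    simpa using this
  have h4 := X_pow_dvd_sub_newtonIter (K := K) h1 h2 h3 (le_refl ℓ)
  rw [X_pow_dvd_iff] at h4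
  have h5 := h4 d (by omega)
  rw [coeff_sub, coeff_map, coeff_map] at h5
  rw [← hg, map_sub, map_aeval_newtonPoint]
  exact h5

end Shift

/-! ### The coefficients of the root along a line -/

section Line

-- instance search has to pass through three nested polynomial rings
set_option maxSynthPendingDepth 8

open Polynomial

variable {K S : Type*} [Field K] [CommRing S] [Algebra K S] {n : ℕ}

/-- Substitution of a line for the coefficients and of `y + b` for the inner variable `y`, with the
parameter `ε` of the line as the new outermost variable. -/
noncomputable def lineHom (θ : S →ₐ[K] S[X]) (b : K) : S[X][X] →ₐ[K] S[X][X][X] :=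
  eval₂AlgHom (eval₂AlgHom ((mapAlgHom
    ((CAlgHom (R := K) (A := S[X])).comp (CAlgHom (R := K) (A := S)))).comp θ)
    (C (C (X + C (algebraMap K S b)))) fun _ => Commute.all _ _) (C X) fun _ => Commute.all _ _

theorem lineHom_X (θ : S →ₐ[K] S[X]) (b : K) : lineHom θ b X = C X :=
  eval₂_X _ _

theorem lineHom_C_X (θ : S →ₐ[K] S[X]) (b : K) :
    lineHom θ b (C X) = C (C (X + C (algebraMap K S b))) :=
  (eval₂_C _ _).trans (eval₂_X _ _)

theorem lineHom_C_C (θ : S →ₐ[K] S[X]) (b : K) (s : S) :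
    lineHom θ b (C (C s)) = (θ s).map ((C : S[X] →+* S[X][X]).comp C) :=
  (eval₂_C _ _).trans (eval₂_C _ _)

theorem lineHom_monomial (θ : S →ₐ[K] S[X]) (b : K) (i l : ℕ) (s : S) :
    lineHom θ b (monomial i (monomial l s)) = (θ s).map ((C : S[X] →+* S[X][X]).comp C) *
      C (C ((X + C (algebraMap K S b)) ^ l) * X ^ i) := by
  rw [← C_mul_X_pow_eq_monomial, ← C_mul_X_pow_eq_monomial, C_mul, C_pow, map_mul, map_mul, map_pow,
    map_pow, lineHom_C_C, lineHom_C_X, lineHom_X, C_mul, C_pow, C_pow, C_pow, mul_assoc]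

theorem coeff_lineHom (θ : S →ₐ[K] S[X]) (b : K) (φ : S[X][X]) (d m j : ℕ) :
    (((lineHom θ b φ).coeff d).coeff m).coeff j =
      ((taylor (algebraMap K S[X] b) ((φ.coeff m).map (θ : S →+* S[X]))).coeff j).coeff d := by
  induction φ using Polynomial.induction_on' with
  | add p q hp hq => simp only [map_add, coeff_add, Polynomial.map_add, hp, hq]
  | monomial i p =>
    induction p using Polynomial.induction_on' with
    | add p q hp hq => simp only [map_add, coeff_add, Polynomial.map_add, hp, hq]
    | monomial l s =>
      rw [lineHom_monomial, coeff_mul_C, coeff_map, coeff_monomial, RingHom.comp_apply,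
        coeff_C_mul, coeff_C_mul, coeff_C_mul, coeff_X_pow,
        apply_ite (fun p : S[X] => p.map (θ : S →+* S[X])), Polynomial.map_zero, map_monomial]
      rcases eq_or_ne i m with rfl | him
      · simp only [if_true, taylor_monomial, coeff_C_mul, mul_one]
        have h2 : ((X + C (algebraMap K S[X] b)) ^ l : S[X][X]) =
            ((X + C (algebraMap K S b)) ^ l).map C := by
          simp [Polynomial.algebraMap_apply]
        rw [h2, coeff_map, coeff_mul_C]
        rfl
      · rw [if_neg him, if_neg (Ne.symm him)]
        simp

/-- The specialization of the coefficients at a point and of `y` to `y + b`. -/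
noncomputable def pointHom (g : S →ₐ[K] K) (b : K) : S[X][X] →ₐ[K] K[X][X] :=
  mapAlgHom ((eval₂AlgHom (CAlgHom.comp g) (X + C b) fun _ => Commute.all _ _ : S[X] →ₐ[K] K[X]))

theorem pointHom_monomial (g : S →ₐ[K] K) (b : K) (i l : ℕ) (s : S) :
    pointHom g b (monomial i (monomial l s)) = C (C (g s) * (X + C b) ^ l) * X ^ i := by
  rw [pointHom, coe_mapAlgHom, map_monomial, C_mul_X_pow_eq_monomial]
  exact congrArg _ (eval₂_monomial _ _)

theorem coeff_zero_lineHom (θ : S →ₐ[K] S[X]) (g : S →ₐ[K] K)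
    (hθ : ∀ s, (θ s).coeff 0 = algebraMap K S (g s)) (b : K) (φ : S[X][X]) :
    (lineHom θ b φ).coeff 0 = mapAlgHom (mapAlgHom (Algebra.ofId K S)) (pointHom g b φ) := by
  induction φ using Polynomial.induction_on' with
  | add p q hp hq => simp only [map_add, coeff_add, hp, hq]
  | monomial i p =>
    induction p using Polynomial.induction_on' with
    | add p q hp hq => simp only [map_add, coeff_add, hp, hq]
    | monomial l s =>
      rw [lineHom_monomial, coeff_mul_C, coeff_map, hθ, pointHom_monomial]
      simp [mul_assoc]

/-- **Expansion of the coefficients of the root.**  Let `φ` be a root of `P` modulo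
`T ^ (m + 1)` with constant value at `T = 0`.  The coefficient of `T ^ m y ^ j ε ^ d` in the
restriction of `φ` to a line is obtained from a universal polynomial in the coefficients of
`P(T, a + ε (w - a), y + b, Z + V)` by a linear functional that takes values in the field on
monomials in `T, y, Z, U`: it substitutes for `Z` the value of the root at `ε = 0` and for `U` the
inverse of the derivative there, both of which only depend on `T` and `y`. -/
theorem exists_functional {P : MvPolynomial (VarTXZ (VarWY n)) K} (hreg : IsTRegularized P)
    (w : Fin n → S) (θ : S →ₐ[K] S[X]) (g : S →ₐ[K] K)
    (hθ : ∀ s, (θ s).coeff 0 = algebraMap K S (g s))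
    (hw : ∀ i, θ (w i) = linePoly (algebraMap K S (g (w i))) (w i)) (b : K) {m : ℕ} {α : K}
    {φ : S[X][X]} (hroot : X ^ (m + 1) ∣ MvPolynomial.aeval
        (pointTXZ X (fun i => C (C (w i))) (C X) φ) P)
    (hα : φ.coeff 0 = algebraMap K _ α) (hsimple : (derivative (fiberPoly P)).eval α ≠ 0)
    (ℓ j : ℕ) :
    (∃ c : K, ((taylor (algebraMap K S[X] b) ((φ.coeff m).map (θ : S →+* S[X]))).coeff j).coeff 0 =
      algebraMap K S c) ∧
    ∃ (L : MvPolynomial (Fin 4) S →ₗ[S] S) (c : (Fin 4 →₀ ℕ) → K),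
      (∀ s, L (MvPolynomial.monomial s 1) = algebraMap K S (c s)) ∧
      ∀ d, 1 ≤ d → d ≤ ℓ →
        ((taylor (algebraMap K S[X] b) ((φ.coeff m).map (θ : S →+* S[X]))).coeff j).coeff d =
        L (MvPolynomial.aeval (R := K) (newtonPoint ℓ
          (shiftedPoly P (MvPolynomial.X 0)
            (fun i => algebraMap K (MvPolynomial (Fin 4) S) (g (w i)))
            (fun i => MvPolynomial.C (w i))
            (MvPolynomial.X 1 + algebraMap K (MvPolynomial (Fin 4) S) b) (MvPolynomial.X 2))
          (MvPolynomial.X 3)) ((newtonIter K ℓ ℓ).coeff d)) := by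
  set ι : K[X][X] →ₐ[K] S[X][X] := mapAlgHom (mapAlgHom (Algebra.ofId K S)) with hι
  have hιcoeff : ∀ p i l, ((ι p).coeff i).coeff l = algebraMap K S ((p.coeff i).coeff l) := by
    intro p i l
    simp [hι]
  set z := pointHom g b φ with hz
  have hz0 : z.coeff 0 = algebraMap K K[X] α := by
    rw [hz, pointHom, coe_mapAlgHom, coeff_map, hα, RingHom.coe_coe, AlgHom.commutes]
  set φ₁ := lineHom θ b φ with hφ₁
  have hφ0 : φ₁.coeff 0 = ι z := coeff_zero_lineHom θ g hθ b φ
  -- the inverse `u` of the derivative at the initial point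
  set y₀ : K[X][X] := C X + algebraMap K K[X][X] b with hy₀
  set D := (basePoly P X (fun i => algebraMap K K[X][X] (g (w i))) y₀ z).coeff 1 with hD
  have hD0 : D.coeff 0 = C ((derivative (fiberPoly P)).eval α) := by
    let c0 : K[X][X] →ₐ[K] K[X] := (aeval (R := K[X]) 0).restrictScalars K
    have hc0 : ∀ p, c0 p = p.coeff 0 := fun p => by simp [c0, coeff_zero_eq_aeval_zero]
    have h1 := congrArg (fun p => p.coeff 1) (map_basePoly c0 P X
      (fun i => algebraMap K K[X][X] (g (w i))) y₀ z)
    rw [hc0 z, hz0, hc0 X, coeff_X_zero, coeff_one_basePoly_zero hreg, coeff_map] at h1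
    rw [← hc0 D]
    exact h1
  obtain ⟨u, hu⟩ : ∃ u, X ^ (m + 1) ∣ u * D - 1 := by
    have hcop : IsCoprime D X := by
      obtain ⟨q, hq⟩ := X_dvd_sub_C (p := D)
      rw [hD0] at hq
      refine ⟨C (C ((derivative (fiberPoly P)).eval α)⁻¹),
        -(C (C ((derivative (fiberPoly P)).eval α)⁻¹) * q), ?_⟩
      rw [sub_eq_iff_eq_add.1 hq, mul_add, ← C_mul, ← C_mul, inv_mul_cancel₀ hsimple]
      simp only [C_1]
      ring
    obtain ⟨u, v, huv⟩ := hcop.pow_right (n := m + 1)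
    exact ⟨u, -v, by linear_combination huv⟩
  let ev : MvPolynomial (Fin 4) S →ₐ[S] S[X][X] := MvPolynomial.aeval ![X, C X, ι z, ι u]
  let evK : MvPolynomial (Fin 4) S →ₐ[K] S[X][X] := ev.restrictScalars K
  have hLcoeff : ∀ s, (((ev (MvPolynomial.monomial s 1)).coeff m).coeff j) =
      algebraMap K S (((X ^ s 0 * (C X) ^ s 1 * z ^ s 2 * u ^ s 3 : K[X][X]).coeff m).coeff j) := by
    intro s
    rw [← hιcoeff]
    congr 2
    simp only [ev, MvPolynomial.aeval_monomial, map_one, one_mul]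
    rw [Finsupp.prod_fintype _ _ fun _ => pow_zero _, Fin.prod_univ_four]
    simp [hι]
  refine ⟨⟨(z.coeff m).coeff j, ?_⟩,
    ((lcoeff S j).comp ((lcoeff S[X] m).restrictScalars S)).comp ev.toLinearMap,
    _, hLcoeff, fun d hd1 hd => ?_⟩
  · rw [← coeff_lineHom, ← hφ₁, hφ0, hιcoeff]
  -- the expansion modulo `T ^ (m + 1)`
  have hG : (shiftedPoly P (MvPolynomial.X 0)
        (fun i => algebraMap K (MvPolynomial (Fin 4) S) (g (w i)))
        (fun i => MvPolynomial.C (w i))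
        (MvPolynomial.X 1 + algebraMap K (MvPolynomial (Fin 4) S) b) (MvPolynomial.X 2)).map
      (mapRingHom (evK : MvPolynomial (Fin 4) S →+* S[X][X])) =
      shiftedPoly P X (fun i => algebraMap K S[X][X] (g (w i))) (fun i => C (C (w i)))
        (C X + algebraMap K S[X][X] b) (ι z) := by
    rw [map_shiftedPoly]
    have e1 : ∀ x, evK (MvPolynomial.X x) = ![X, C X, ι z, ι u] x := fun x => by simp [evK, ev]
    have e2 : ∀ s, evK (MvPolynomial.C s) = C (C s) := fun s => by
      simp [evK, ev, Polynomial.algebraMap_apply]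
    simp [e1, e2]
  have hmem := coeff_sub_newtonIter_mem (K := K) (Ideal.span {(X : S[X][X]) ^ (m + 1)}) (ℓ := ℓ)
    (G := shiftedPoly P X (fun i => algebraMap K S[X][X] (g (w i))) (fun i => C (C (w i)))
        (C X + algebraMap K S[X][X] b) (ι z)) (f := φ₁ - C (ι z)) (u := ι u) ?_ ?_ ?_ hd
  · rw [Ideal.mem_span_singleton, coeff_sub, coeff_C, if_neg (by omega), sub_zero,
      X_pow_dvd_iff] at hmem
    have h1 := hmem m (by omega)
    rw [coeff_sub, sub_eq_zero] at h1
    rw [← coeff_lineHom, ← hφ₁, h1]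
    change _ = (coeff (evK _) m).coeff j
    rw [map_aeval_newtonPoint, hG]
    have e1 : evK (MvPolynomial.X 3) = ι u := by simp [evK, ev]
    rw [e1]
  · rw [X_dvd_iff, coeff_sub, hφ0, coeff_C_zero, sub_self]
  · intro i
    rw [eval_shiftedPoly, add_sub_cancel, Ideal.mem_span_singleton]
    have h1 := map_aeval_pointTXZ (lineHom θ b) X (fun i => C (C (w i))) (C X) φ P
    obtain ⟨q, hq⟩ := hroot
    have e1 : lineHom θ b X = C X := by simp [lineHom]
    have e2 : lineHom θ b (C X) = C (C X + algebraMap K S[X][X] b) := by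
      simp [lineHom, Polynomial.algebraMap_apply]
    have e3 : ∀ i, lineHom θ b (C (C (w i))) =
        linePoly (algebraMap K S[X][X] (g (w i))) (C (C (w i))) := by
      intro i
      simp [lineHom, hw, map_linePoly, Polynomial.algebraMap_apply]
    simp only [e1, e2, e3] at h1
    rw [← hφ₁] at h1
    rw [← h1, hq, map_mul, map_pow, e1, ← C_pow, coeff_C_mul]
    exact dvd_mul_right _ _
  · rw [coeff_zero_shiftedPoly, Ideal.mem_span_singleton]
    have h1 := congrArg (fun p => p.coeff 1) (map_basePoly ι P X
      (fun i => algebraMap K K[X][X] (g (w i))) y₀ z)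
    simp only [coeff_map, RingHom.coe_coe] at h1
    have e1 : ι X = X := by simp [hι]
    have e2 : ι y₀ = C X + algebraMap K S[X][X] b := by
      rw [hy₀, map_add, AlgHom.commutes]
      simp [hι]
    simp only [e1, e2, AlgHom.commutes] at h1
    rw [← h1, ← map_mul, ← map_one ι, ← map_sub]
    obtain ⟨q, hq⟩ := hu
    rw [hq, map_mul, map_pow, e1]
    exact dvd_mul_right _ _

end Line

/-! ### Circuits for the coefficients along a line -/

namespace IsDegreeFiltration

variable {A : Type*} [CommRing A] {𝒟 : ℕ → A → Prop}

theorem coeff_C (h : IsDegreeFiltration 𝒟) {e : ℕ} {a : A} (ha : 𝒟 e a) (n : ℕ) :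
    𝒟 e ((Polynomial.C a).coeff n) := by
  rw [Polynomial.coeff_C]
  split_ifs
  exacts [ha, h.zero e]

theorem coeff_X (h : IsDegreeFiltration 𝒟) (n : ℕ) :
    𝒟 0 ((Polynomial.X : Polynomial A).coeff n) := by
  rw [Polynomial.coeff_X]
  split_ifs
  exacts [h.one, h.zero 0]

end IsDegreeFiltration

section Circuits

open Polynomial

variable {K : Type*} [Field K] {n : ℕ}

theorem hasCircuit_line (a r : K) (i : Fin n) :
    HasCircuit (MvPolynomial.C a + MvPolynomial.C r *
      (MvPolynomial.X i - MvPolynomial.C a) : MvPolynomial (Fin n) K) 2 6 := by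
  classical
  have h : (MvPolynomial.C a + MvPolynomial.C r *
      (MvPolynomial.X i - MvPolynomial.C a) : MvPolynomial (Fin n) K) =
      MvPolynomial.monomial 0 (a - r * a) + MvPolynomial.monomial (Finsupp.single i 1) r := by
    rw [← MvPolynomial.C_mul_X_eq_monomial, ← MvPolynomial.C_apply, map_sub, map_mul]
    ring
  rw [h]
  refine hasCircuit_of_card_support_le (N := 2) (E := 1) _ ?_ ?_
  · refine (Finset.card_le_card MvPolynomial.support_add).trans
      ((Finset.card_union_le _ _).trans ?_)
    exact (add_le_add (Finset.card_le_card MvPolynomial.support_monomial_subset)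
      (Finset.card_le_card MvPolynomial.support_monomial_subset)).trans (by simp)
  · refine (MvPolynomial.totalDegree_add _ _).trans (max_le ?_ ?_)
    · exact (MvPolynomial.totalDegree_monomial_le _ _).trans (by simp)
    · exact (MvPolynomial.totalDegree_monomial_le _ _).trans (by simp)

/-- The coefficient of `V ^ j ε ^ d` in `P(t, a + ε (w - a), y, z + V)`, by interpolation in
`ε` and `V`. -/
theorem exists_coeff_shiftedPoly_eq_sum [CharZero K] {S : Type*} [CommRing S] [Algebra K S]
    (P : MvPolynomial (VarTXZ (VarWY n)) K) (j d : ℕ) :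
    ∃ γ : (Fin 2 → Fin (P.totalDegree + 1)) → K, ∀ (t : S) (a w : Fin n → S) (y z : S),
      ((shiftedPoly P t a w y z).coeff j).coeff d = ∑ r, γ r • MvPolynomial.aeval
        (pointTXZ t (fun i => a i + algebraMap K S ((r 0 : ℕ) : K) * (w i - a i)) y
          (z + algebraMap K S ((r 1 : ℕ) : K))) P := by
  let ev : MvPolynomial (Fin 2) S →ₐ[S] S[X][X] := MvPolynomial.aeval ![C X, X]
  let L : MvPolynomial (Fin 2) S →ₗ[S] S :=
    ((lcoeff S d).comp ((lcoeff S[X] j).restrictScalars S)).comp ev.toLinearMap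
  have hL : ∀ m, L (MvPolynomial.monomial m 1) =
      algebraMap K S (if j = m 1 then if d = m 0 then 1 else 0 else 0) := by
    intro m
    have h1 : ev (MvPolynomial.monomial m 1) = C (X ^ m 0) * X ^ m 1 := by
      simp only [ev, MvPolynomial.aeval_monomial, map_one, one_mul]
      rw [Finsupp.prod_fintype _ _ fun _ => pow_zero _, Fin.prod_univ_two]
      simp
    change ((ev _).coeff j).coeff d = _
    rw [h1, coeff_C_mul, coeff_X_pow]
    split_ifs <;> simp_all [coeff_X_pow]
  obtain ⟨γ, hγ⟩ := exists_interpolation P.totalDegree L _ hL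
  refine ⟨γ, fun t a w y z => ?_⟩
  set p : MvPolynomial (Fin 2) S := MvPolynomial.aeval (pointTXZ (MvPolynomial.C t)
    (fun i => MvPolynomial.C (a i) + MvPolynomial.X 0 * MvPolynomial.C (w i - a i))
    (MvPolynomial.C y) (MvPolynomial.C z + MvPolynomial.X 1)) P with hp
  have hpdeg : p.totalDegree ≤ P.totalDegree := by
    have hF := IsDegreeFiltration.totalDegree (A := S) (Fin 2)
    have hC : ∀ s : S, (MvPolynomial.C s : MvPolynomial (Fin 2) S).totalDegree ≤ 0 := fun s => by
      simp
    have hX : ∀ i, (MvPolynomial.X i : MvPolynomial (Fin 2) S).totalDegree ≤ 1 := fun i => by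
      rw [MvPolynomial.X]
      exact (MvPolynomial.totalDegree_monomial_le _ _).trans (by simp)
    refine hF.aeval (fun c => by rw [MvPolynomial.algebraMap_apply]; exact hC _) (fun v => ?_) P
    rcases v with _ | (i | _) | _
    · exact hF.mono zero_le_one (hC _)
    · exact hF.add (hF.mono zero_le_one (hC _)) (hF.mul (hX _) (hC _))
    · exact hF.mono zero_le_one (hC _)
    · exact hF.add (hF.mono zero_le_one (hC _)) (hX _)
  have hev : ev p = shiftedPoly P t a w y z := by
    refine Eq.trans (map_aeval_pointTXZ (ev.restrictScalars K) _ _ _ _ P) ?_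
    simp [shiftedPoly, ev, linePoly, Polynomial.algebraMap_apply]
  have hcoef : ((shiftedPoly P t a w y z).coeff j).coeff d = L p := by
    rw [← hev]
    rfl
  rw [hcoef, hγ p hpdeg]
  refine Finset.sum_congr rfl fun r _ => congrArg _ ?_
  refine Eq.trans (map_aeval_pointTXZ ((MvPolynomial.aeval (R := S)
    (fun i => algebraMap K S ((r i : ℕ) : K))).restrictScalars K) _ _ _ _ P) ?_
  simp

theorem hasCircuit_coeff_shiftedPoly [CharZero K] {P : MvPolynomial (VarTXZ (VarWY n)) K}
    {Δ s : ℕ} (hP : HasCircuit P Δ s) (t y z : K) (a : Fin n → K) (j d : ℕ) :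
    HasCircuit (((shiftedPoly P (MvPolynomial.C t) (fun i => MvPolynomial.C (a i))
      (fun i => MvPolynomial.X i) (MvPolynomial.C y)
      (MvPolynomial.C z) : (MvPolynomial (Fin n) K)[X][X]).coeff j).coeff d) (Δ + 6)
      (((P.totalDegree + 1) ^ 2 * 3 + 2) * ((s + 2) * 8) - 2) := by
  obtain ⟨γ, hγ⟩ := exists_coeff_shiftedPoly_eq_sum (S := MvPolynomial (Fin n) K) P j d
  rw [hγ]
  refine (HasCircuit.linearCombination (Δ := Δ + 3) (s := (s + 2) * 8 - 2) γ
    fun r => ?_).mono le_rfl (le_of_eq ?_)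
  · refine (hP.comp (Δ₂ := 2) (s₂ := 6) fun v => ?_).mono (by omega) le_rfl
    rcases v with _ | (i | _) | _
    · exact hasCircuit_C _ _ _
    · exact hasCircuit_line _ _ _
    · exact hasCircuit_C _ _ _
    · change HasCircuit (MvPolynomial.C z + MvPolynomial.C _) _ _
      rw [← MvPolynomial.C_add]
      exact hasCircuit_C _ _ _
  · rw [show (s + 2) * 8 - 2 + 2 = (s + 2) * 8 by omega]
    simp

theorem totalDegree_newtonPoint_shiftedPoly_le {S : Type*} [CommRing S] [Algebra K S]
    (P : MvPolynomial (VarTXZ (VarWY n)) K) (a : Fin n → K) (w : Fin n → S) (b : K) (ℓ : ℕ)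
    (v : Option (Fin (ℓ + 1) × Fin (ℓ + 1))) :
    (newtonPoint ℓ (shiftedPoly P (MvPolynomial.X 0)
      (fun i => algebraMap K (MvPolynomial (Fin 4) S) (a i)) (fun i => MvPolynomial.C (w i))
      (MvPolynomial.X 1 + algebraMap K (MvPolynomial (Fin 4) S) b) (MvPolynomial.X 2))
      (MvPolynomial.X 3) v).totalDegree ≤ P.totalDegree + 1 := by
  have hF := IsDegreeFiltration.totalDegree (A := S) (Fin 4)
  have hF1 := hF.polynomial
  have hF2 := hF1.polynomial
  have hC : ∀ s : S, (MvPolynomial.C s : MvPolynomial (Fin 4) S).totalDegree ≤ 0 := fun s => by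
    simp
  have hX : ∀ i, (MvPolynomial.X i : MvPolynomial (Fin 4) S).totalDegree ≤ 1 := fun i => by
    rw [MvPolynomial.X]
    exact (MvPolynomial.totalDegree_monomial_le _ _).trans (by simp)
  have hK : ∀ c : K, (algebraMap K (MvPolynomial (Fin 4) S) c).totalDegree ≤ 0 := fun c => by
    rw [MvPolynomial.algebraMap_apply]
    exact hC _
  rcases v with _ | ⟨j, d⟩
  · exact (hX _).trans (by omega)
  refine (hF2.aeval (K := K) (fun c => ?_) (fun v => ?_) P j d).trans (Nat.le_succ _)
  · exact hF1.coeff_C (hF.coeff_C (hK c))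
  have h1 : ∀ p : MvPolynomial (Fin 4) S, p.totalDegree ≤ 1 → ∀ i l,
      (((C (C p) : (MvPolynomial (Fin 4) S)[X][X]).coeff i).coeff l).totalDegree ≤ 1 :=
    fun p hp => hF1.coeff_C (hF.coeff_C hp)
  rcases v with _ | (i | _) | _
  · exact h1 _ (hX _)
  · refine hF1.coeff_C (hF1.mono zero_le_one (hF1.add (hF.coeff_C (hK _)) ?_))
    refine hF1.mul (e := 0) (e' := 0) hF.coeff_X (hF.coeff_C ?_)
    rw [sub_eq_add_neg]
    exact hF.add (hC _) (hF.neg (hK _))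
  · exact h1 _ (hF.add (hX _) (hF.mono zero_le_one (hK _)))
  · exact hF2.add (h1 _ (hX _)) (hF2.mono zero_le_one hF1.coeff_X)

/-- The bound, increased by `2`, for the size of the universal polynomials of Newton iteration. -/
def newtonSize (ℓ : ℕ) : ℕ :=
  ((ℓ + 2) ^ ℓ + 1) ^ ((ℓ + 1) * (ℓ + 1) + 1) * ((ℓ + 2) ^ ℓ + 2) + 2

theorem hasCircuit_newton {ℓ : ℕ} (W : MvPolynomial (Option (Fin (ℓ + 1) × Fin (ℓ + 1))) K)
    (hW : W.totalDegree ≤ (ℓ + 2) ^ ℓ) : HasCircuit W 2 (newtonSize ℓ - 2) := by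
  refine (hasCircuit_of_totalDegree_le W hW).mono le_rfl (le_of_eq ?_)
  simp [newtonSize]

local notation "𝕊" => MvPolynomial (Fin n) K

/-- The coefficients along a line of the coefficient of `T ^ m y ^ j` of a root `φ` of `P`
modulo `T ^ (m + 1)`.  The bound depends on neither `m` nor `j`. -/
theorem hasCircuit_coeff_root [CharZero K] {P : MvPolynomial (VarTXZ (VarWY n)) K} {Δ s : ℕ}
    (hP : HasCircuit P Δ s) (hreg : IsTRegularized P)
    (θ : 𝕊 →ₐ[K] 𝕊[X])
    (a : Fin n → K) (hθ : ∀ f, (θ f).coeff 0 = MvPolynomial.C (MvPolynomial.aeval a f))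
    (hw : ∀ i, θ (MvPolynomial.X i) = linePoly (MvPolynomial.C (a i)) (MvPolynomial.X i))
    (b : K) {m : ℕ} {α : K} {φ : 𝕊[X][X]}
    (hroot : X ^ (m + 1) ∣ MvPolynomial.aeval
        (pointTXZ X (fun i => C (C (MvPolynomial.X i))) (C X) φ) P)
    (hα : φ.coeff 0 = algebraMap K _ α) (hsimple : (derivative (fiberPoly P)).eval α ≠ 0)
    (κ : K) (ℓ j d : ℕ) (hd : d ≤ ℓ) :
    HasCircuit (κ • ((taylor (algebraMap K 𝕊[X] b)
      ((φ.coeff m).map (θ : 𝕊 →+* 𝕊[X]))).coeff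
        j).coeff d) (Δ + 12)
      ((((ℓ + 2) ^ ℓ * (P.totalDegree + 1) + 1) ^ 4 * 3 + 2) * (newtonSize ℓ *
        (((P.totalDegree + 1) ^ 2 * 3 + 2) * ((s + 2) * 8))) - 2) := by
  obtain ⟨⟨c, hc⟩, L, cL, hL, h⟩ := exists_functional hreg (fun i => MvPolynomial.X i) θ
    (MvPolynomial.aeval a) hθ (fun i => by rw [hw, MvPolynomial.aeval_X]; rfl) b hroot hα hsimple
    ℓ j
  obtain rfl | hd0 := Nat.eq_zero_or_pos d
  -- at `ε = 0` the coefficient is a field constant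
  · rw [hc, Algebra.smul_def, ← map_mul]
    exact hasCircuit_C _ _ _
  rw [h d hd0 hd]
  simp only [MvPolynomial.aeval_X]
  set N := (ℓ + 2) ^ ℓ * (P.totalDegree + 1) with hN
  obtain ⟨γ, hγ⟩ := exists_interpolation N L _ hL
  rw [hγ, Finset.smul_sum]
  · simp only [← mul_smul]
    have hpt : ∀ r : Fin 4 → Fin (N + 1), HasCircuit
        (MvPolynomial.eval (fun i => algebraMap K 𝕊 ((r i : ℕ) : K))
          (MvPolynomial.aeval (R := K) (newtonPoint ℓ
          (shiftedPoly P (MvPolynomial.X 0)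
            (fun i => algebraMap K (MvPolynomial (Fin 4) 𝕊) (a i))
            (fun i => MvPolynomial.C (MvPolynomial.X i))
            (MvPolynomial.X 1 + algebraMap K (MvPolynomial (Fin 4) 𝕊) b) (MvPolynomial.X 2))
          (MvPolynomial.X 3)) ((newtonIter K ℓ ℓ).coeff d))) (Δ + 9)
        (newtonSize ℓ * (((P.totalDegree + 1) ^ 2 * 3 + 2) * ((s + 2) * 8)) - 2) := by
      intro r
      let ev : MvPolynomial (Fin 4) 𝕊 →ₐ[K] 𝕊 :=
        (MvPolynomial.aeval (R := 𝕊) fun i => algebraMap K 𝕊 ((r i : ℕ) : K)).restrictScalars K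
      have hevX : ∀ i, ev (MvPolynomial.X i) = MvPolynomial.C ((r i : ℕ) : K) := fun i => by
        simp only [ev, AlgHom.restrictScalars_apply, MvPolynomial.aeval_X]
        rfl
      have hevC : ∀ f, ev (MvPolynomial.C f) = f := fun f => by
        simp [ev]
      change HasCircuit (ev _) _ _
      rw [map_aeval_newtonPoint, map_shiftedPoly]
      simp only [hevX, hevC, map_add, AlgHom.commutes]
      refine ((hasCircuit_newton _ (totalDegree_coeff_newtonIter_le K ℓ ℓ d)).comp
        (Δ₂ := Δ + 6) (s₂ := ((P.totalDegree + 1) ^ 2 * 3 + 2) * ((s + 2) * 8) - 2)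
        fun v => ?_).mono (by omega) (le_of_eq ?_)
      · rcases v with _ | ⟨j', d'⟩
        · exact hasCircuit_C _ _ _
        · have := hasCircuit_coeff_shiftedPoly hP ((r 0 : ℕ) : K) (((r 1 : ℕ) : K) + b)
            ((r 2 : ℕ) : K) a j' d'
          rw [MvPolynomial.C_add] at this
          exact this
      · have h1 : newtonSize ℓ - 2 + 2 = newtonSize ℓ := by simp [newtonSize]
        have h2 : 2 ≤ ((P.totalDegree + 1) ^ 2 * 3 + 2) * ((s + 2) * 8) := by nlinarith
        rw [h1, Nat.sub_add_cancel h2]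
    refine (HasCircuit.linearCombination (fun r => κ * γ r) hpt).mono le_rfl (le_of_eq ?_)
    have h2 : 2 ≤ newtonSize ℓ * (((P.totalDegree + 1) ^ 2 * 3 + 2) * ((s + 2) * 8)) := by
      refine le_trans (b := newtonSize ℓ * 1) (by simp [newtonSize]) (Nat.mul_le_mul_left _ ?_)
      nlinarith
    rw [Nat.sub_add_cancel h2]
    simp
  · have hF := (IsDegreeFiltration.totalDegree (A := 𝕊) (Fin 4)).scale (P.totalDegree + 1)
    refine (hF.aeval (fun c => ?_) (fun v => ?_) _).trans
      (Nat.mul_le_mul_right _ (totalDegree_coeff_newtonIter_le K ℓ ℓ d))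
    · rw [MvPolynomial.algebraMap_apply, MvPolynomial.totalDegree_C]
      exact Nat.zero_le _
    · rw [one_mul]
      exact totalDegree_newtonPoint_shiftedPoly_le P a _ b ℓ v

theorem derivative_taylor {A : Type*} [CommRing A] (r : A) (f : A[X]) :
    derivative (taylor r f) = taylor r (derivative f) := by
  simp [taylor_apply, derivative_comp]

theorem iterate_derivative_taylor {A : Type*} [CommRing A] (r : A) (f : A[X]) (e : ℕ) :
    derivative^[e] (taylor r f) = taylor r (derivative^[e] f) := by
  induction e with
  | zero => rfl
  | succ e ih => rw [Function.iterate_succ_apply', ih, derivative_taylor,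
      Function.iterate_succ_apply']

/-- A root `F`, of bounded degree, of a coefficient `φ.coeff m` of a root `φ` of `P`
modulo `T ^ (m + 1)`. -/
theorem hasCircuit_of_dvd_coeff_root [CharZero K] {P : MvPolynomial (VarTXZ (VarWY n)) K}
    {Δ s ℓ : ℕ} (hP : HasCircuit P Δ s) (hreg : IsTRegularized P) {m : ℕ} {α : K}
    {φ : 𝕊[X][X]} {F : 𝕊}
    (hroot : X ^ (m + 1) ∣ MvPolynomial.aeval
        (pointTXZ X (fun i => C (C (MvPolynomial.X i))) (C X) φ) P)
    (hα : φ.coeff 0 = algebraMap K _ α) (hsimple : (derivative (fiberPoly P)).eval α ≠ 0)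
    (hφ : φ.coeff m ≠ 0) (hF : X - C F ∣ φ.coeff m) (hℓ : F.totalDegree ≤ ℓ) :
    HasCircuit F (Δ + 15) (newtonSize ℓ *
      ((((ℓ + 2) ^ ℓ * (P.totalDegree + 1) + 1) ^ 4 * 3 + 2) * (newtonSize ℓ *
        (((P.totalDegree + 1) ^ 2 * 3 + 2) * ((s + 2) * 8)))) - 2) := by
  -- `F` is a simple root of `M`, and stays simple at the point `a`
  obtain ⟨e, he0, he1⟩ := exists_iterate_derivative_simple_root hφ hF
  set M := derivative^[e] (φ.coeff m) with hM
  rw [Function.iterate_succ_apply', ← hM] at he1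
  obtain ⟨a, ha⟩ : ∃ a : Fin n → K, MvPolynomial.aeval a ((derivative M).eval F) ≠ 0 := by
    by_contra! h
    exact he1 (MvPolynomial.funext fun x => by simpa [MvPolynomial.aeval_eq_eval] using h x)
  set b : K := MvPolynomial.aeval a F with hb
  set β : K := MvPolynomial.aeval a ((derivative M).eval F) with hβ
  let θ : 𝕊 →ₐ[K] 𝕊[X] :=
    MvPolynomial.aeval fun i => linePoly (MvPolynomial.C (a i)) (MvPolynomial.X i)
  have hw : ∀ i, θ (MvPolynomial.X i) = linePoly (MvPolynomial.C (a i)) (MvPolynomial.X i) :=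
    fun i => MvPolynomial.aeval_X _ i
  let c0 : 𝕊[X] →ₐ[K] 𝕊 := (aeval (R := 𝕊) 0).restrictScalars K
  have hc0 : ∀ p, c0 p = p.coeff 0 := fun p => by simp [c0, coeff_zero_eq_aeval_zero]
  have hθ : ∀ f, (θ f).coeff 0 = MvPolynomial.C (MvPolynomial.aeval a f) := by
    intro f
    have h1 : c0.comp θ = (Algebra.ofId K 𝕊).comp (MvPolynomial.aeval a) := by
      refine MvPolynomial.algHom_ext fun i => ?_
      rw [AlgHom.comp_apply, hw, AlgHom.comp_apply, MvPolynomial.aeval_X, hc0]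
      simp [linePoly, Algebra.ofId_apply, MvPolynomial.algebraMap_eq]
    rw [← hc0]
    exact congrArg (fun g : 𝕊 →ₐ[K] 𝕊 => g f) h1
  have hθ1 : ∀ f, (θ f).eval 1 = f := by
    intro f
    have h1 : ((aeval (R := 𝕊) 1).restrictScalars K).comp θ = AlgHom.id K 𝕊 := by
      refine MvPolynomial.algHom_ext fun i => ?_
      rw [AlgHom.comp_apply, hw]
      simp [linePoly]
    exact congrArg (fun g : 𝕊 →ₐ[K] 𝕊 => g f) h1
  have hθdeg : (θ F).natDegree ≤ ℓ := by
    refine (IsDegreeFiltration.natDegree.aeval (fun c => ?_) (fun i => ?_) F).trans hℓ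
    · rw [Polynomial.algebraMap_apply, natDegree_C]
    · refine natDegree_add_le_of_degree_le (by simp) ?_
      exact (natDegree_mul_C_le _ _).trans natDegree_X_le
  -- the expansion of `M` around `y = b` along the line through `a`
  set G : 𝕊[X][X] := taylor (algebraMap K 𝕊[X] b) (M.map (θ : 𝕊 →+* 𝕊[X])) with hG
  set f : 𝕊[X] := θ F - algebraMap K 𝕊[X] b with hf
  have hGf : G.eval f = 0 := by
    rw [hG, taylor_eval, hf, sub_add_cancel, eval_map]
    have := hom_eval₂ M (RingHom.id 𝕊) (θ : 𝕊 →+* 𝕊[X]) F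
    rw [RingHom.comp_id] at this
    refine Eq.trans this.symm ?_
    change θ (M.eval F) = 0
    rw [he0, map_zero]
  have hXf : X ∣ f := by
    rw [X_dvd_iff, hf, coeff_sub, hθ, Polynomial.algebraMap_apply, coeff_C_zero, ← hb]
    exact sub_self _
  have hG1 : (G.coeff 1).coeff 0 = algebraMap K 𝕊 β := by
    rw [hG, taylor_coeff_one, derivative_map, ← hc0, eval_map]
    have h1 := hom_eval₂ (derivative M) (θ : 𝕊 →+* 𝕊[X]) (c0 : 𝕊[X] →+* 𝕊)
      (algebraMap K 𝕊[X] b)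
    have h2 := hom_eval₂ (derivative M) (RingHom.id 𝕊)
      ((algebraMap K 𝕊).comp (MvPolynomial.aeval a : 𝕊 →ₐ[K] K)) F
    refine Eq.trans h1 (Eq.trans ?_ h2.symm)
    have h3 : (c0 : 𝕊[X] →+* 𝕊).comp (θ : 𝕊 →+* 𝕊[X]) =
        (algebraMap K 𝕊).comp (MvPolynomial.aeval a : 𝕊 →ₐ[K] K) := by
      exact RingHom.ext fun x => (hc0 _).trans (hθ x)
    rw [RingHom.comp_id, h3]
    congr 1
    exact AlgHom.commutes c0 b
  have hexp : ∀ d, d ≤ ℓ → f.coeff d = MvPolynomial.aeval (R := K)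
      (newtonPoint ℓ G (algebraMap K 𝕊 β⁻¹)) ((newtonIter K ℓ ℓ).coeff d) := by
    intro d hd
    have := coeff_sub_newtonIter_mem (K := K) (⊥ : Ideal 𝕊)
      (u := algebraMap K 𝕊 β⁻¹) hXf
      (fun i => by rw [hGf]; exact zero_mem _)
      (by rw [hG1, ← map_mul, inv_mul_cancel₀ ha, map_one, sub_self]; exact zero_mem _) hd
    rwa [Ideal.mem_bot, sub_eq_zero] at this
  -- `ε = 1` recovers `F`, which has no terms beyond `ε ^ ℓ` along the line
  have hFW : F = MvPolynomial.aeval (R := K) (newtonPoint ℓ G (algebraMap K 𝕊 β⁻¹))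
      (MvPolynomial.C b + ∑ d ∈ Finset.range (ℓ + 1), (newtonIter K ℓ ℓ).coeff d) := by
    have h1 : F = algebraMap K 𝕊 b + f.eval 1 := by
      rw [hf, eval_sub, hθ1, Polynomial.algebraMap_apply, eval_C]
      ring
    have h2 : f.natDegree < ℓ + 1 := by
      refine Nat.lt_succ_of_le ((natDegree_sub_le _ _).trans (max_le hθdeg ?_))
      rw [Polynomial.algebraMap_apply, natDegree_C]
      exact Nat.zero_le _
    rw [map_add, MvPolynomial.aeval_C, map_sum]
    refine h1.trans ?_
    rw [eval_eq_sum_range' h2]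
    congr 1
    refine Finset.sum_congr rfl fun d hd => ?_
    rw [one_pow, mul_one, hexp d (Nat.lt_succ_iff.1 (Finset.mem_range.1 hd))]
  rw [hFW]
  refine ((hasCircuit_newton _ ?_).comp (Δ₂ := Δ + 12)
    (s₂ := (((ℓ + 2) ^ ℓ * (P.totalDegree + 1) + 1) ^ 4 * 3 + 2) * (newtonSize ℓ *
        (((P.totalDegree + 1) ^ 2 * 3 + 2) * ((s + 2) * 8))) - 2)
    fun v => ?_).mono (by omega) (le_of_eq ?_)
  · refine (MvPolynomial.totalDegree_add _ _).trans (max_le (by simp) ?_)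
    exact MvPolynomial.totalDegree_finsetSum_le fun d _ =>
      totalDegree_coeff_newtonIter_le K ℓ ℓ d
  · rcases v with _ | ⟨j, d⟩
    · exact hasCircuit_C _ _ _
    · have h1 : (G.coeff j).coeff d = (((j + e : ℕ).descFactorial e : ℕ) : K) •
          ((taylor (algebraMap K 𝕊[X] b) ((φ.coeff m).map (θ : 𝕊 →+* 𝕊[X]))).coeff
            (j + e)).coeff d := by
        rw [hG, hM, ← iterate_derivative_map, ← iterate_derivative_taylor,
          coeff_iterate_derivative, coeff_smul, Nat.cast_smul_eq_nsmul]
      have h2 := hasCircuit_coeff_root hP hreg θ a hθ hw b hroot hα hsimple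
        (((j + e : ℕ).descFactorial e : ℕ) : K) ℓ (j + e) d (Nat.lt_succ_iff.1 d.2)
      rw [← h1] at h2
      exact h2
  · have h1 : newtonSize ℓ - 2 + 2 = newtonSize ℓ := by simp [newtonSize]
    have h2 : 2 ≤ (((ℓ + 2) ^ ℓ * (P.totalDegree + 1) + 1) ^ 4 * 3 + 2) * (newtonSize ℓ *
        (((P.totalDegree + 1) ^ 2 * 3 + 2) * ((s + 2) * 8))) := by
      refine le_trans (b := 2 * 1) le_rfl (Nat.mul_le_mul (by omega) ?_)
      exact Nat.mul_pos (by simp [newtonSize]) (by positivity)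
    rw [h1, Nat.sub_add_cancel h2]

end Circuits

/-! ### The size bound -/

theorem newtonSize_le (ℓ : ℕ) :
    newtonSize ℓ ≤ ((ℓ + 2) ^ ℓ + 2) ^ ((ℓ + 1) * (ℓ + 1) + 3) := by
  set E := (ℓ + 2) ^ ℓ
  set V := (ℓ + 1) * (ℓ + 1) + 1
  have h1 : (E + 1) ^ V * (E + 2) ≤ (E + 2) ^ (V + 1) := by
    rw [pow_succ (E + 2) V]
    exact Nat.mul_le_mul_right _ (Nat.pow_le_pow_left (by omega) _)
  have h2 : 2 ≤ (E + 2) ^ (V + 1) :=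
    (by omega : 2 ≤ E + 2).trans (Nat.le_self_pow (by omega) _)
  have h3 : (E + 2) ^ (V + 1) * 2 ≤ (E + 2) ^ (V + 1) * (E + 2) := by
    gcongr
    omega
  calc newtonSize ℓ = (E + 1) ^ V * (E + 2) + 2 := rfl
    _ ≤ (E + 2) ^ (V + 1) * (E + 2) := by omega
    _ = _ := by rw [← pow_succ]

theorem iterate_degree_le (ℓ : ℕ) : (ℓ + 2) ^ ℓ + 2 ≤ 2 ^ (ℓ * ℓ + ℓ + 2) := by
  have h1 : ℓ + 2 ≤ 2 ^ (ℓ + 1) := (ℓ + 1).lt_two_pow_self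
  have h2 : (ℓ + 2) ^ ℓ ≤ 2 ^ (ℓ * ℓ + ℓ) := by
    calc (ℓ + 2) ^ ℓ ≤ (2 ^ (ℓ + 1)) ^ ℓ := Nat.pow_le_pow_left h1 ℓ
      _ = _ := by rw [← pow_mul]; ring_nf
  have h3 : 1 ≤ 2 ^ (ℓ * ℓ + ℓ) := Nat.one_le_two_pow
  rw [pow_add]
  omega

theorem size_bound (ℓ s D : ℕ) :
    newtonSize ℓ * ((((ℓ + 2) ^ ℓ * (D + 1) + 1) ^ 4 * 3 + 2) * (newtonSize ℓ *
      (((D + 1) ^ 2 * 3 + 2) * ((s + 2) * 8)))) ≤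
    200 * (s + 2) * (D + 1) ^ 6 *
      2 ^ ((ℓ * ℓ + ℓ + 2) * (2 * ((ℓ + 1) * (ℓ + 1) + 3) + 4)) := by
  set E := (ℓ + 2) ^ ℓ with hE
  set V := (ℓ + 1) * (ℓ + 1) + 3
  have h1 : newtonSize ℓ ≤ (E + 2) ^ V := newtonSize_le ℓ
  have h2 : (E * (D + 1) + 1) ^ 4 * 3 + 2 ≤ 5 * ((E + 2) ^ 4 * (D + 1) ^ 4) := by
    have h : E * (D + 1) + 1 ≤ (E + 2) * (D + 1) := by nlinarith
    have h' := Nat.pow_le_pow_left h 4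
    rw [mul_pow] at h'
    have h'' : 1 ≤ (E + 2) ^ 4 * (D + 1) ^ 4 := Nat.one_le_iff_ne_zero.2 (by positivity)
    omega
  have h3 : (D + 1) ^ 2 * 3 + 2 ≤ 5 * (D + 1) ^ 2 := by
    have : 1 ≤ (D + 1) ^ 2 := Nat.one_le_pow _ _ (by omega)
    omega
  calc _ ≤ (E + 2) ^ V * ((5 * ((E + 2) ^ 4 * (D + 1) ^ 4)) * ((E + 2) ^ V *
        ((5 * (D + 1) ^ 2) * ((s + 2) * 8)))) := by gcongr
    _ = 200 * (s + 2) * (D + 1) ^ 6 * (E + 2) ^ (2 * V + 4) := by ring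
    _ ≤ _ := by
        rw [pow_mul]
        gcongr
        exact iterate_degree_le ℓ

theorem lemma7p1 :
    ∃ (c : ℕ) (p : MvPolynomial (Fin 2) ℕ) (q : Polynomial ℕ),
      ∀ (𝔽 : Type*) [Field 𝔽] [CharZero 𝔽] (n Δ s k ℓ : ℕ)
        (P : MvPolynomial (VarTXZ (VarWY n)) 𝔽) (R : MvPolynomial (VarTX (VarWY n)) 𝔽)
        (F : MvPolynomial (Fin n) 𝔽),
        1 < k →
        HasCircuit P Δ s →
        IsTRegularized P →
        IsMonicInZ P →
        IsApproxRoot P R k →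
        IsTruncated R k →
        IsNondegenerate P R →
        substZ P R ≠ 0 →
        F.totalDegree ≤ ℓ →
        ySub F ∣ substZ P R →
        HasCircuit F (Δ + c)
          (MvPolynomial.eval ![s, P.totalDegree] p * (Nat.log 2 k + 1) ^ q.eval ℓ) := by
  refine ⟨15, 200 * (MvPolynomial.X 0 + 2) * (MvPolynomial.X 1 + 1) ^ 6,
    (Polynomial.X * Polynomial.X + Polynomial.X + 2) *
      (2 * ((Polynomial.X + 1) * (Polynomial.X + 1) + 3) + 4), ?_⟩
  intro 𝔽 _ _ n Δ s k ℓ P R F hk hP hreg _ hroot htr hnd hne hℓ hF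
  obtain ⟨m, α, φ, h1, h2, h3, h4, h5⟩ := exists_root_mod_X_pow hk hreg hroot htr hnd hne hF
  refine (hasCircuit_of_dvd_coeff_root hP hreg h1 h2 h3 h4 h5 hℓ).mono le_rfl ?_
  refine (Nat.sub_le _ _).trans ((size_bound ℓ s P.totalDegree).trans ?_)
  have hlog : 2 ≤ Nat.log 2 k + 1 := Nat.succ_le_succ (Nat.log_pos Nat.one_lt_two hk)
  simp only [map_mul, map_add, map_pow, MvPolynomial.eval_X, map_ofNat, map_one,
    Matrix.cons_val_zero, Matrix.cons_val_one, Polynomial.eval_mul, Polynomial.eval_add,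
    Polynomial.eval_X, Polynomial.eval_ofNat, Polynomial.eval_one]
  exact Nat.mul_le_mul_left _ (Nat.pow_le_pow_left hlog _)
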